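/- **Setting.** Let $\mathcal T$ be the class of maps $g:\bigcup_k I_k\to J$ with a critical point $c$ such that: $\{I_k\}$ is a (finite or infinite) family of pairwise disjoint nondegenerate compact intervals in the interior of the compact interval $J$; for $k\ne0$ the map $g$ sends $I_k$ ($c\notin I_k$) $C^3$-diffeomorphically onto $J$, with Schwarzian derivative $\le0$; the central interval is $I_0=[c-r,c+r]$ with $r>0$, $g(I_0)\subset J$, $g(\partial I_0)\subset\partial J$, and $g|I_0=h\circ\phi$, where $\phi(x)=(x-c)^2$ and $h$ is a $C^3$ diffeomorphism of $[0,r^2]$ onto its image with Schwarzian derivative $\le 0$. Let $g\in\mathcal T$ have a recurrent critical point: all iterates $g^m(c)$ are defined and $c\in\omega(c)$. Put $g_1=g$, $I^0=J$, $I^1_k=I_k$, and inductively, writing $I^n=I^n_0\ni c$ for the central interval of $g_n:\bigcup_k I^n_k\to I^{n-1}$, let $g_{n+1}:\bigcup_k I^{n+1}_k\to I^n$ be the first return map of $g_n$ to $I^n$ restricted to those components of its domain that meet the orbit of $c$. Set - $\mu_n=|I^n|/|I^{n-1}|$; - $\lambda_n=\sup_{k\neq0}P(I^n_k\,|\,I^{n-1})$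 and $\lambda_n^*=\min(\lambda_n,1)$, where $P(G|L)=\log\left(1+\frac{|G|}{|U|}\right)+\log\left(1+\frac{|G|}{|V|}\right)$ and $U,V$ are the components of $L\setminus G$; - $K_n=\inf Q(U,V)$ over all pairs of distinct intervals $U,V$ of level $n$ with $U$ closer to $c$ than $V$ that either lie on the same side of $c$ or have $U$ central, where $Q(U,V)=\log\left(1+\frac{|G|}{|U|}\right)+\frac12\log\left(1+\frac{|G|}{|V|}\right)$ and $G$ is the gap between $U$ and $V$; - $\rho_n=\sup_k\sup_{z,w\in\phi(I^n_k)}\log\frac{|h_{n,k}'(z)|}{|h_{n,k}'(w)|}$, where $g_n|I^n_k=h_{n,k}\circ\phi$. **Lemma 3.13.** Let $0<\bar\rho<\bar\mu<1$ and $\epsilon>0$. There is a constant $C>0$, depending only on $\bar\mu$, $\bar\rho$ and $\epsilon$, with the following property. Let $g\in\mathcal T$ have a recurrent critical point $c$, and let $n\ge2$; if $n=2$, assume that $J$ is symmetric about $c$. Suppose that $\rho_i<\bar\rho$ and $\mu_i<\bar\mu$ for $i=n-1,n$, and that the return is non-central: $g_n(c)\notin I^n$. Then at least one of the following three estimates holds: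 $$\mu_{n+1}\le C\sqrt{\lambda_n^*}\,\exp\left(-(1-\epsilon)K_n/2\right),$$ $$\mu_{n+1}\le C\exp\left(-(1+\epsilon/2)K_n/2\right),$$ $$\mu_{n+1}\le C\sqrt{\mu_n\,\mu_{n-1}\,\lambda_{n-1}^*}.$$ -/

import Mathlib

open scoped ENNReal

noncomputable section

namespace BoxMap

/-! ## Closed intervals -/

/-- A compact interval `[fst, snd]` of the real line (with `fst ≤ snd`). -/
abbrev Seg := NonemptyInterval ℝ

/-- The set of points of a compact interval. -/
def pts (K : Seg) : Set ℝ := Set.Icc K.fst K.snd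

/-- The length `|K|`. -/
def len (K : Seg) : ℝ := K.snd - K.fst

/-! ## Smooth branches, Schwarzian derivative, distortion -/

/-- The Schwarzian derivative `f''' / f' - (3/2) (f'' / f')²`. -/
def schwarzian (f : ℝ → ℝ) (x : ℝ) : ℝ :=
  iteratedDeriv 3 f x / deriv f x - 3 / 2 * (iteratedDeriv 2 f x / deriv f x) ^ 2

/-- `f` restricted to `[a, b]` is a `C³` diffeomorphism onto its image (one-sided derivatives at
the endpoints) whose Schwarzian derivative is nowhere positive. -/
structure IsSDiffeo (f : ℝ → ℝ) (a b : ℝ) : Prop where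
  smooth : ContDiffOn ℝ 3 f (Set.Icc a b)
  deriv_ne : ∀ x ∈ Set.Icc a b, derivWithin f (Set.Icc a b) x ≠ 0
  schwarz : ∀ x ∈ Set.Ioo a b, schwarzian f x ≤ 0

/-- The distortion (non-linearity) of `f` on `S`: the supremum of `log (|f' x| / |f' y|)` over
`x, y ∈ S`.  It is a supremum of a nonempty family containing `0` as soon as `S` is nonempty, so
nothing is lost by taking it in `[0, ∞]`. -/
def distortion (f : ℝ → ℝ) (S : Set ℝ) : ℝ≥0∞ :=
  ⨆ x ∈ S, ⨆ y ∈ S, ENNReal.ofReal (Real.log (|derivWithin f S x| / |derivWithin f S y|))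

/-! ## Poincaré lengths -/

/-- The Poincaré length `P(G | L) = log (1 + |G| / |U|) + log (1 + |G| / |V|)` of `G ⊂ int L`,
where `U`, `V` are the two components of `L \ G`. -/
def poincareLen (G L : Seg) : ℝ :=
  Real.log (1 + len G / (G.fst - L.fst)) + Real.log (1 + len G / (L.snd - G.snd))

/-- The length of the gap between two disjoint intervals, that is, of the bounded component of
`ℝ \ (U ∪ V)`. -/
def gapLen (U V : Seg) : ℝ := max (V.fst - U.snd) (U.fst - V.snd)

/-- The asymmetric Poincaré length `Q(U, V)` of the gap `G` between `U` and `V`, where `U` is the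
interval closer to the critical point: `log (1 + |G| / |U|) + (1/2) log (1 + |G| / |V|)`. -/
def asymLen (U V : Seg) : ℝ :=
  Real.log (1 + gapLen U V / len U) + 1 / 2 * Real.log (1 + gapLen U V / len V)

/-- `U` and `V` are disjoint, `U` is closer to `c` than `V`, and the gap between them does not
contain `c`: either `U` contains `c`, or both lie on the same side of `c`. -/
def Closer (c : ℝ) (U V : Seg) : Prop :=
  (c ≤ U.snd ∧ U.snd < V.fst) ∨ (U.fst ≤ c ∧ V.snd < U.fst)

/-! ## Return maps -/

/-- The data of a map `g : ⋃ I_k → J` defined on a family of compact intervals (`pieces`).  The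
values of `g` off the union of the pieces are irrelevant. -/
structure RMap where
  J : Seg
  pieces : Set Seg
  g : ℝ → ℝ

/-- The class `𝒯` (with critical point `c`, the map being purely quadratic near `c`):
the pieces are pairwise disjoint nondegenerate compact intervals in the interior of `J`; every piece
not containing `c` is mapped diffeomorphically onto `J`; one piece is `I₀ = [c - r, c + r]`, and
there `g = h ∘ φ` with `φ x = (x - c)²` and `h` a diffeomorphism, and `g` is a unimodal map of
`I₀` into `J` carrying `∂I₀` into `∂J`.  All the diffeomorphisms have Schwarzian derivative
`≤ 0`. -/
structure ClassT (c : ℝ) (G : RMap) : Prop where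
  nondeg : ∀ K ∈ G.pieces, K.fst < K.snd
  interior : ∀ K ∈ G.pieces, G.J.fst < K.fst ∧ K.snd < G.J.snd
  disjoint : ∀ K ∈ G.pieces, ∀ K' ∈ G.pieces, K ≠ K' → Disjoint (pts K) (pts K')
  noncentral : ∀ K ∈ G.pieces, c ∉ pts K →
    IsSDiffeo G.g K.fst K.snd ∧ G.g '' pts K = pts G.J
  central : ∃ K ∈ G.pieces, ∃ r > 0, K.fst = c - r ∧ K.snd = c + r ∧
    ∃ h : ℝ → ℝ, IsSDiffeo h 0 (r ^ 2) ∧ (∀ x ∈ pts K, G.g x = h ((x - c) ^ 2)) ∧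
      h 0 ∈ pts G.J ∧ (h (r ^ 2) = G.J.fst ∨ h (r ^ 2) = G.J.snd)

/-- The critical point is recurrent: all its iterates are defined, and it is an accumulation point
of its own orbit, `c ∈ ω(c)`. -/
def Recurrent (c : ℝ) (G : RMap) : Prop :=
  (∀ m : ℕ, ∃ K ∈ G.pieces, G.g^[m] c ∈ pts K) ∧
    MapClusterPt c Filter.atTop (fun m : ℕ => G.g^[m] c)

open Classical in
/-- The central interval: the piece that contains `c` (`J` if there is none, which does not happen
for the maps of class `𝒯`). -/
def centralPiece (c : ℝ) (G : RMap) : Seg :=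
  if h : ∃ K ∈ G.pieces, c ∈ pts K then h.choose else G.J

/-- `K` is contained in the central interval `I`, and all its points return to `I` for the first
time at the moment `k ≥ 1`, passing before that through the same non-central pieces. -/
def IsReturnSeg (c : ℝ) (G : RMap) (k : ℕ) (K : Seg) : Prop :=
  1 ≤ k ∧ pts K ⊆ pts (centralPiece c G) ∧
    (∀ i, 1 ≤ i → i < k → ∃ K' ∈ G.pieces, c ∉ pts K' ∧ G.g^[i] '' pts K ⊆ pts K') ∧
    G.g^[k] '' pts K ⊆ pts (centralPiece c G)

/-- The first return time of `x` to the central interval. -/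
def returnTime (c : ℝ) (G : RMap) (x : ℝ) : ℕ :=
  sInf {k : ℕ | 1 ≤ k ∧ G.g^[k] x ∈ pts (centralPiece c G)}

/-- The pre-renormalization of `G`: the first return map to the central interval `I`, restricted to
those components of its domain (maximal intervals of points returning together) which meet the orbit
of the critical point. -/
def preRenorm (c : ℝ) (G : RMap) : RMap where
  J := centralPiece c G
  pieces := {K | (∃ k, Maximal (IsReturnSeg c G k) K) ∧ ∃ m : ℕ, G.g^[m] c ∈ pts K}
  g := fun x => G.g^[returnTime c G x] x

/-- The sequence `g_n : ⋃ I^n_k → I^{n-1}`, `n ≥ 1`: `g_1 = G` and `g_{n+1}` is the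
pre-renormalization of `g_n`. -/
def level (c : ℝ) (G : RMap) (n : ℕ) : RMap := (preRenorm c)^[n - 1] G

/-! ## Geometric parameters of a map `g : ⋃ I_k → J` -/

/-- The scaling factor `μ = |I₀| / |J|`. -/
def scaling (c : ℝ) (G : RMap) : ℝ := len (centralPiece c G) / len G.J

/-- `K`, the infimum of the asymmetric Poincaré lengths of the gaps between two pieces lying on the
same side of `c`, or one of which is central. -/
def gapParam (c : ℝ) (G : RMap) : ℝ :=
  sInf {q | ∃ U ∈ G.pieces, ∃ V ∈ G.pieces, Closer c U V ∧ q = asymLen U V}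

/-- `λ`, the supremum of the Poincaré lengths `P(I_k | J)` of the non-central pieces. -/
def lam (c : ℝ) (G : RMap) : ℝ≥0∞ :=
  ⨆ K ∈ {K ∈ G.pieces | c ∉ pts K}, ENNReal.ofReal (poincareLen K G.J)

/-- `λ* = min (λ, 1)`. -/
def lamStar (c : ℝ) (G : RMap) : ℝ := (min (lam c G) 1).toReal

/-- The factor `h` of the decomposition `g|K = h ∘ φ`, `φ x = (x - c)²`, as a function of
`z = φ x`. -/
def quadFactor (c : ℝ) (G : RMap) (K : Seg) (z : ℝ) : ℝ :=
  if K.snd < c then G.g (c - √z) else G.g (c + √z)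

/-- The distortion parameter `ρ`: the supremum over all pieces `K` of the distortion of `h` on
`φ(K)`, where `g|K = h ∘ φ`. -/
def distParam (c : ℝ) (G : RMap) : ℝ≥0∞ :=
  ⨆ K ∈ G.pieces, distortion (quadFactor c G K) ((fun x => (x - c) ^ 2) '' pts K)

end BoxMap

end

namespace BoxMap
open Set

/-! Let R₀ < R₁ < R₂ be the radii of I^n, I^{n-1}, I^{n-2}, so that μ_n = R₀/R₁ and μ_{n-1} = R₁/R₂.
As the return is non-central, g_n sends I^{n+1} into a non-central piece V of level n, lying at
distances from a to b from c. The image later returns to I^n, so pulling I^n ⊂ I^{n-1} back along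
its itinerary bounds its cross ratio in V by O(μ_n) (`cross_le_of_return`). With the quadratic tip
and the distortion bound this gives μ_{n+1}² = O(μ_n |V|/(R₁-b)) (`exists_piece_scaling_sq_le`).

If V stays at distance at least κR₁ from ∂I^{n-1}, write Q(I^n, V) = x + y/2 ≥ K_n. Then μ_n ≤
e^{-x}, while |V|/(R₁-b) is both O(λ_n^*) and O(e^{-y}). A small y yields the first estimate, a
large y the second. If V is close to ∂I^{n-1}, it cannot return under a single step of g_{n-1}, so
g_{n-1}(V) lies in a non-central piece of level n-1. The cross ratio there, transported through the
central branch, gives |V|/(R₁-b) = O(μ_{n-1} λ_{n-1}^*), hence the third estimate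
(`outer_gap_alternative`, `scaling_alternative`).

The Schwarzian condition enters only through the inequality that branches do not decrease the cross
ratio |G||L|/(|U||V|) = exp P(G|L) - 1. This inequality survives restriction and composition, so
`QuadBox`, which retains just this, passes to every level together with recurrence. -/

/-! ### From non-positive Schwarzian derivative to the cross-ratio inequality. -/

/-- A differentiable strictly monotone branch on `[a, b]` with non-vanishing derivative which does
not decrease the Poincaré lengths of intervals (written as an inequality of cross ratios). -/
structure CrossDiffeo (f : ℝ → ℝ) (a b : ℝ) : Prop where
  lt : a < b
  hasDeriv : ∀ x ∈ Icc a b, ∃ d, d ≠ 0 ∧ HasDerivWithinAt f d (Icc a b) x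
  mono : StrictMonoOn f (Icc a b) ∨ StrictAntiOn f (Icc a b)
  cross : ∀ p x y q, a ≤ p → p ≤ x → x ≤ y → y ≤ q → q ≤ b →
    (y - x) * (q - p) * ((f x - f p) * (f q - f y)) ≤
      (f y - f x) * (f q - f p) * ((x - p) * (q - y))

section Convexity

variable {f w : ℝ → ℝ} {a b : ℝ}

/-- Equality holds when `w` is affine, that is, for Möbius `f`. In general `w` lies below its chord
`l`, so `1 / w ^ 2 ≥ 1 / l ^ 2`, and the latter integrates over `[x, y]` to the left-hand side. -/
theorem two_point_of_convexOn (hf : ContinuousOn f (Icc a b)) (hw : ConvexOn ℝ (Icc a b) w)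
    (hpos : ∀ t ∈ Icc a b, 0 < w t) (hd : ∀ t ∈ Ioo a b, HasDerivAt f (1 / w t ^ 2) t)
    {x y : ℝ} (hx : a ≤ x) (hxy : x < y) (hy : y ≤ b) :
    (y - x) / (w x * w y) ≤ f y - f x := by
  have hwx := hpos x ⟨hx, by linarith⟩
  have hwy := hpos y ⟨by linarith, hy⟩
  set m : ℝ := (w y - w x) / (y - x) with hm
  have hyx : 0 < y - x := by linarith
  have hm' : m * (y - x) = w y - w x := by rw [hm]; field_simp
  set l : ℝ → ℝ := fun s => w x + m * (s - x) with hl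
  have hwl : ∀ s ∈ Icc x y, w s ≤ l s := by
    intro s hs
    have h : w (((y - s) / (y - x)) • x + ((s - x) / (y - x)) • y) ≤
        ((y - s) / (y - x)) • w x + ((s - x) / (y - x)) • w y :=
      hw.2 ⟨hx, by linarith⟩ ⟨by linarith, hy⟩
      (div_nonneg (by linarith [hs.2]) hyx.le) (div_nonneg (by linarith [hs.1]) hyx.le)
      (by field_simp; ring)
    have e1 : ((y - s) / (y - x)) • x + ((s - x) / (y - x)) • y = s := by
      simp only [smul_eq_mul]; field_simp; ring
    have e2 : ((y - s) / (y - x)) • w x + ((s - x) / (y - x)) • w y = l s := by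
      simp only [smul_eq_mul, hl, hm]; field_simp; ring
    rwa [e1, e2] at h
  have hlpos : ∀ s ∈ Icc x y, 0 < l s := fun s hs =>
    (hpos s ⟨hx.trans hs.1, hs.2.trans hy⟩).trans_le (hwl s hs)
  have hld : ∀ s, HasDerivAt l m s := by
    intro s
    have := (((hasDerivAt_id s).sub_const x).const_mul m).const_add (w x)
    simpa [hl] using this
  -- The primitive of `1 / l ^ 2` that vanishes at `x`.
  have hT : ∀ s ∈ Icc x y, HasDerivAt (fun s => (s - x) / (w x * l s)) (1 / l s ^ 2) s := by
    intro s hs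
    have h0 := hlpos s hs
    have := ((hasDerivAt_id s).sub_const x).div ((hld s).const_mul (w x)) (by positivity)
    refine this.congr_deriv ?_
    simp only [id]
    field_simp
    simp only [hl]; ring
  have hmono : MonotoneOn (fun s => f s - (s - x) / (w x * l s)) (Icc x y) := by
    apply monotoneOn_of_deriv_nonneg (convex_Icc x y)
    · apply ContinuousOn.sub (hf.mono (Icc_subset_Icc hx hy))
      exact fun s hs => (hT s hs).continuousAt.continuousWithinAt
    · rw [interior_Icc]
      intro s hs
      exact ((hd s ⟨by linarith [hs.1], by linarith [hs.2]⟩).sub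
        (hT s (Ioo_subset_Icc_self hs))).differentiableAt.differentiableWithinAt
    · rw [interior_Icc]
      intro s hs
      have hs' := Ioo_subset_Icc_self hs
      have h := (hd s ⟨by linarith [hs.1], by linarith [hs.2]⟩).sub (hT s hs')
      change 0 ≤ deriv (f - fun s => (s - x) / (w x * l s)) s
      rw [HasDerivAt.deriv h, sub_nonneg]
      have h1 := hpos s ⟨hx.trans hs'.1, hs'.2.trans hy⟩
      have h2 := hwl s hs'
      gcongr
  have := hmono (left_mem_Icc.2 hxy.le) (right_mem_Icc.2 hxy.le) hxy.le
  simp only [sub_self, zero_div, sub_zero] at this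
  have e : l y = w y := by simp only [hl]; linarith
  rw [e] at this
  linarith

/-- The two-point inequality says that the mixed derivative ∂ₛ∂ₜ of log (t - s) - log (f t - f s) is
non-negative. Integrating it over `[p, x] × [y, q]` compares the cross ratios. -/
theorem cross_of_convexOn (hf : ContinuousOn f (Icc a b)) (hw : ConvexOn ℝ (Icc a b) w)
    (hpos : ∀ t ∈ Icc a b, 0 < w t) (hd : ∀ t ∈ Ioo a b, HasDerivAt f (1 / w t ^ 2) t)
    {p x y q : ℝ} (hp : a ≤ p) (hpx : p ≤ x) (hxy : x ≤ y) (hyq : y ≤ q) (hq : q ≤ b) :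
    (y - x) * (q - p) * ((f x - f p) * (f q - f y)) ≤
      (f y - f x) * (f q - f p) * ((x - p) * (q - y)) := by
  rcases hpx.eq_or_lt with rfl | hpx
  · simp
  rcases hyq.eq_or_lt with rfl | hyq
  · simp
  rcases hxy.eq_or_lt with rfl | hxy
  · simp
  have htwo : ∀ {s t}, a ≤ s → s < t → t ≤ b → (t - s) / (w s * w t) ≤ f t - f s :=
    fun h1 h2 h3 => two_point_of_convexOn hf hw hpos hd h1 h2 h3
  have hlt : ∀ {s t}, a ≤ s → s < t → t ≤ b → 0 < f t - f s := by
    intro s t h1 h2 h3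
    refine lt_of_lt_of_le ?_ (htwo h1 h2 h3)
    have := hpos s ⟨h1, by linarith⟩
    have := hpos t ⟨by linarith, h3⟩
    have : 0 < t - s := by linarith
    positivity
  -- Integration in s over `[p, x]`, with t fixed.
  have hk : ∀ t ∈ Ioo y q, 1 / (t - p) - 1 / w t ^ 2 / (f t - f p) ≤
      1 / (t - x) - 1 / w t ^ 2 / (f t - f x) := by
    intro t ht
    have hder : ∀ s ∈ Ioo p x, HasDerivAt (fun s => 1 / (t - s) - 1 / w t ^ 2 / (f t - f s))
        (1 / (t - s) ^ 2 - 1 / w t ^ 2 * (1 / w s ^ 2) / (f t - f s) ^ 2) s := by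
      intro s hs
      have h1 : t - s ≠ 0 := by linarith [hs.2, ht.1]
      have h2 : f t - f s ≠ 0 :=
        (hlt (by linarith [hs.1]) (by linarith [hs.2, ht.1]) (by linarith [ht.2])).ne'
      have A := (hasDerivAt_const s (1 : ℝ)).div ((hasDerivAt_id s).const_sub t) h1
      have B := (hasDerivAt_const s (1 / w t ^ 2)).div
        ((hd s ⟨by linarith [hs.1], by linarith [hs.2]⟩).const_sub (f t)) h2
      refine (A.sub B).congr_deriv ?_
      simp only [id]
      ring
    have hcont : ContinuousOn (fun s => 1 / (t - s) - 1 / w t ^ 2 / (f t - f s)) (Icc p x) := by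
      apply ContinuousOn.sub
      · apply ContinuousOn.div continuousOn_const (by fun_prop)
        intro s hs
        linarith [hs.2, ht.1]
      · apply ContinuousOn.div continuousOn_const
        · exact continuousOn_const.sub (hf.mono (Icc_subset_Icc hp (by linarith)))
        · intro s hs
          exact (hlt (by linarith [hs.1]) (by linarith [hs.2, ht.1]) (by linarith [ht.2])).ne'
    have hmono := monotoneOn_of_deriv_nonneg (convex_Icc p x) hcont
      (by rw [interior_Icc]; exact fun s hs => (hder s hs).differentiableAt.differentiableWithinAt)
      (by
        rw [interior_Icc]
        intro s hs
        rw [(hder s hs).deriv, sub_nonneg]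
        have hst : 0 < t - s := by linarith [hs.2, ht.1]
        have h1 := hpos s ⟨by linarith [hs.1], by linarith [hs.2]⟩
        have h2 := hpos t ⟨by linarith [ht.1], by linarith [ht.2]⟩
        have h3 := htwo (s := s) (t := t) (by linarith [hs.1]) (by linarith) (by linarith [ht.2])
        have h4 : 0 < (t - s) / (w s * w t) := by positivity
        calc 1 / w t ^ 2 * (1 / w s ^ 2) / (f t - f s) ^ 2
            ≤ 1 / w t ^ 2 * (1 / w s ^ 2) / ((t - s) / (w s * w t)) ^ 2 := by gcongr
          _ = 1 / (t - s) ^ 2 := by field_simp)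
    exact hmono (left_mem_Icc.2 hpx.le) (right_mem_Icc.2 hpx.le) hpx.le
  -- Integration in t over `[y, q]`: `hk` says exactly that ψ has non-positive derivative.
  set ψ : ℝ → ℝ := fun t => Real.log (t - p) - Real.log (t - x) -
    (Real.log (f t - f p) - Real.log (f t - f x)) with hψ
  have hpt : ∀ t ∈ Icc y q, t - p ≠ 0 ∧ t - x ≠ 0 ∧ f t - f p ≠ 0 ∧ f t - f x ≠ 0 := by
    intro t ht
    exact ⟨by linarith [ht.1], by linarith [ht.1],
      (hlt hp (by linarith [ht.1]) (by linarith [ht.2])).ne',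
      (hlt (by linarith) (by linarith [ht.1]) (by linarith [ht.2])).ne'⟩
  have hanti : AntitoneOn ψ (Icc y q) := by
    have hfc : ContinuousOn f (Icc y q) := hf.mono (Icc_subset_Icc (by linarith) hq)
    have hder : ∀ t ∈ Ioo y q, HasDerivAt ψ (1 / (t - p) - 1 / (t - x) -
        (1 / w t ^ 2 / (f t - f p) - 1 / w t ^ 2 / (f t - f x))) t := by
      intro t ht
      obtain ⟨h1, h2, h3, h4⟩ := hpt t (Ioo_subset_Icc_self ht)
      have hft := hd t ⟨by linarith [ht.1], by linarith [ht.2]⟩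
      have hid := hasDerivAt_id t
      exact (((hid.sub_const p).log h1).sub ((hid.sub_const x).log h2)).sub
        (((hft.sub_const (f p)).log h3).sub ((hft.sub_const (f x)).log h4))
    apply antitoneOn_of_deriv_nonpos (convex_Icc y q)
    · refine ContinuousOn.sub (ContinuousOn.sub ?_ ?_) (ContinuousOn.sub ?_ ?_)
      · exact ContinuousOn.log (by fun_prop) fun t ht => (hpt t ht).1
      · exact ContinuousOn.log (by fun_prop) fun t ht => (hpt t ht).2.1
      · exact ContinuousOn.log (by fun_prop) fun t ht => (hpt t ht).2.2.1
      · exact ContinuousOn.log (by fun_prop) fun t ht => (hpt t ht).2.2.2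
    · rw [interior_Icc]
      exact fun t ht => (hder t ht).differentiableAt.differentiableWithinAt
    · rw [interior_Icc]
      intro t ht
      rw [(hder t ht).deriv]
      linarith [hk t ht]
  have h := hanti (left_mem_Icc.2 hyq.le) (right_mem_Icc.2 hyq.le) hyq.le
  have P1 : 0 < q - p := by linarith
  have P2 : 0 < q - x := by linarith
  have P3 : 0 < y - p := by linarith
  have P4 : 0 < y - x := by linarith
  have F1 := hlt hp (by linarith : p < q) hq
  have F2 := hlt (by linarith) (by linarith : x < q) hq
  have F3 := hlt hp (by linarith : p < y) (by linarith)
  have F4 := hlt (by linarith) hxy (by linarith)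
  have hl : Real.log ((q - p) * (f q - f x) * ((y - x) * (f y - f p))) ≤
      Real.log ((q - x) * (f q - f p) * ((y - p) * (f y - f x))) := by
    rw [Real.log_mul (by positivity) (by positivity), Real.log_mul (by positivity) (by positivity),
      Real.log_mul (by positivity) (by positivity), Real.log_mul (by positivity) (by positivity),
      Real.log_mul (by positivity) (by positivity), Real.log_mul (by positivity) (by positivity)]
    simp only [hψ] at h
    linarith
  have := (Real.log_le_log_iff (by positivity) (by positivity)).1 hl
  -- The inequality obtained has (q - x)(y - p) in place of (x - p)(q - y). These differ by (y -
  -- x)(q - p), both for the points and for their images, so the two forms are equivalent.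
  nlinarith [this]

end Convexity

theorem CrossDiffeo.neg {f : ℝ → ℝ} {a b : ℝ} (h : CrossDiffeo (fun x => -f x) a b) :
    CrossDiffeo f a b where
  lt := h.lt
  hasDeriv x hx := by
    obtain ⟨d, hd, h'⟩ := h.hasDeriv x hx
    exact ⟨-d, neg_ne_zero.2 hd, by simpa using h'.fun_neg⟩
  mono := by
    rcases h.mono with h | h
    · exact Or.inr fun x hx y hy hxy => neg_lt_neg_iff.1 (h hx hy hxy)
    · exact Or.inl fun x hx y hy hxy => neg_lt_neg_iff.1 (h hx hy hxy)
  cross p x y q h1 h2 h3 h4 h5 := by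
    have := h.cross p x y q h1 h2 h3 h4 h5
    linarith

/-- For w = (f')^(-1/2) one has w'' = -(1/2) w S(f), where S(f) is the Schwarzian derivative. -/
theorem convexOn_rpow_deriv {f : ℝ → ℝ} {a b : ℝ} (hab : a < b)
    (hs : ContDiffOn ℝ 3 f (Icc a b)) (hpos : ∀ x ∈ Icc a b, 0 < derivWithin f (Icc a b) x)
    (hS : ∀ x ∈ Ioo a b, schwarzian f x ≤ 0) :
    ConvexOn ℝ (Icc a b) (fun x => derivWithin f (Icc a b) x ^ (-(1 / 2) : ℝ)) := by
  have hU := uniqueDiffOn_Icc hab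
  have hDc : ContinuousOn (derivWithin f (Icc a b)) (Icc a b) :=
    hs.continuousOn_derivWithin hU (by norm_num)
  have hEq : ∀ x ∈ Ioo a b, derivWithin f (Icc a b) x = deriv f x := fun x hx =>
    derivWithin_of_mem_nhds (Icc_mem_nhds hx.1 hx.2)
  have hat : ∀ x ∈ Ioo a b, ContDiffAt ℝ 3 f x := fun x hx =>
    hs.contDiffAt (Icc_mem_nhds hx.1 hx.2)
  have hD1 : ∀ x ∈ Ioo a b, HasDerivAt (deriv f) (iteratedDeriv 2 f x) x := by
    intro x hx
    have h2 : ContDiffAt ℝ 2 (deriv f) x := (hat x hx).derivWithin (by norm_num)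
    have := (h2.differentiableAt (by norm_num)).hasDerivAt
    rwa [iteratedDeriv_succ, iteratedDeriv_one]
  have hD2 : ∀ x ∈ Ioo a b, HasDerivAt (iteratedDeriv 2 f) (iteratedDeriv 3 f x) x := by
    intro x hx
    have h2 : ContDiffAt ℝ 2 (deriv f) x := (hat x hx).derivWithin (by norm_num)
    have h1 : ContDiffAt ℝ 1 (deriv (deriv f)) x := h2.derivWithin (by norm_num)
    have := (h1.differentiableAt (by norm_num)).hasDerivAt
    have e : iteratedDeriv 2 f = deriv (deriv f) := by rw [iteratedDeriv_succ, iteratedDeriv_one]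
    have e' : iteratedDeriv 3 f = deriv (iteratedDeriv 2 f) := iteratedDeriv_succ
    rw [e', e]
    exact this
  have hne : ∀ x ∈ Ioo a b, 0 < deriv f x := fun x hx =>
    hEq x hx ▸ hpos x (Ioo_subset_Icc_self hx)
  refine convexOn_of_hasDerivWithinAt2_nonneg (convex_Icc a b)
    (f' := fun x => -(1 / 2) * deriv f x ^ (-(3 / 2) : ℝ) * iteratedDeriv 2 f x)
    (f'' := fun x => -(1 / 2) * deriv f x ^ (-(1 / 2) : ℝ) * schwarzian f x) ?_ ?_ ?_ ?_
  · exact hDc.rpow_const fun x hx => Or.inl (hpos x hx).ne'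
  · rw [interior_Icc]
    intro x hx
    have h := ((hD1 x hx).rpow_const (p := -(1 / 2)) (Or.inl (hne x hx).ne')).hasDerivWithinAt
      (s := Ioo a b)
    refine (h.congr (fun y hy => by rw [hEq y hy]) (by rw [hEq x hx])).congr_deriv ?_
    norm_num
    ring
  · rw [interior_Icc]
    intro x hx
    have h0 := hne x hx
    have h := (((hD1 x hx).rpow_const (p := -(3 / 2)) (Or.inl h0.ne')).const_mul
      (-(1 / 2))).mul (hD2 x hx)
    refine h.hasDerivWithinAt.congr_deriv ?_
    have e1 : deriv f x ^ (-(3 / 2) : ℝ) = deriv f x ^ (-(1 / 2) : ℝ) / deriv f x := by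
      rw [← Real.rpow_sub_one h0.ne']; norm_num
    have e2 : deriv f x ^ (-(3 / 2) - 1 : ℝ) = deriv f x ^ (-(1 / 2) : ℝ) / deriv f x ^ 2 := by
      rw [Real.rpow_sub_one h0.ne', e1]; field_simp
    rw [e1, e2, schwarzian]
    field_simp
    ring
  · rw [interior_Icc]
    intro x hx
    have := Real.rpow_pos_of_pos (hne x hx) (-(1 / 2) : ℝ)
    nlinarith [hS x hx]

theorem CrossDiffeo.of_deriv_pos {f : ℝ → ℝ} {a b : ℝ} (hab : a < b)
    (hs : ContDiffOn ℝ 3 f (Icc a b)) (hpos : ∀ x ∈ Icc a b, 0 < derivWithin f (Icc a b) x)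
    (hS : ∀ x ∈ Ioo a b, schwarzian f x ≤ 0) : CrossDiffeo f a b where
  lt := hab
  hasDeriv x hx := ⟨_, (hpos x hx).ne',
    (hs.differentiableOn (by norm_num) x hx).hasDerivWithinAt⟩
  mono := by
    left
    apply strictMonoOn_of_deriv_pos (convex_Icc a b) hs.continuousOn
    rw [interior_Icc]
    intro x hx
    rw [← derivWithin_of_mem_nhds (Icc_mem_nhds hx.1 hx.2)]
    exact hpos x (Ioo_subset_Icc_self hx)
  cross p x y q h1 h2 h3 h4 h5 := by
    refine cross_of_convexOn hs.continuousOn (convexOn_rpow_deriv hab hs hpos hS)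
      (fun t ht => Real.rpow_pos_of_pos (hpos t ht) _) ?_ h1 h2 h3 h4 h5
    intro t ht
    have h0 := hpos t (Ioo_subset_Icc_self ht)
    have := (hs.differentiableOn (by norm_num) t
      (Ioo_subset_Icc_self ht)).hasDerivWithinAt.hasDerivAt (Icc_mem_nhds ht.1 ht.2)
    refine this.congr_deriv ?_
    rw [← Real.rpow_natCast, ← Real.rpow_mul h0.le]
    norm_num
    rw [Real.rpow_neg_one, inv_inv]

theorem IsSDiffeo.crossDiffeo {f : ℝ → ℝ} {a b : ℝ} (hab : a < b) (h : IsSDiffeo f a b) :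
    CrossDiffeo f a b := by
  have hc : ContinuousOn (derivWithin f (Icc a b)) (Icc a b) :=
    h.smooth.continuousOn_derivWithin (uniqueDiffOn_Icc hab) (by norm_num)
  have hsign : (∀ x ∈ Icc a b, 0 < derivWithin f (Icc a b) x) ∨
      (∀ x ∈ Icc a b, derivWithin f (Icc a b) x < 0) := by
    by_contra! hcon
    obtain ⟨⟨x, hx, hx'⟩, y, hy, hy'⟩ := hcon
    obtain ⟨z, hz, hz'⟩ := isPreconnected_Icc.intermediate_value hx hy hc ⟨hx', hy'⟩
    exact h.deriv_ne z hz hz'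
  rcases hsign with hs | hs
  · exact .of_deriv_pos hab h.smooth hs h.schwarz
  · apply CrossDiffeo.neg
    refine .of_deriv_pos hab h.smooth.neg ?_ ?_
    · intro x hx
      have : derivWithin (fun x => -f x) (Icc a b) x = - derivWithin f (Icc a b) x :=
        derivWithin.fun_neg
      rw [this]
      linarith [hs x hx]
    · intro x hx
      have : schwarzian (fun x => -f x) x = schwarzian f x := by
        simp only [schwarzian]
        rw [iteratedDeriv_fun_neg, iteratedDeriv_fun_neg, deriv.fun_neg]
        simp [neg_div_neg_eq]
      rw [this]
      exact h.schwarz x hx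

/-! ### Restriction, composition and preimages for cross-ratio branches. -/

namespace CrossDiffeo

variable {f g : ℝ → ℝ} {a b a' b' : ℝ}

theorem continuousOn (h : CrossDiffeo f a b) : ContinuousOn f (Icc a b) := fun x hx => by
  obtain ⟨d, -, hd⟩ := h.hasDeriv x hx
  exact hd.continuousWithinAt

theorem injOn (h : CrossDiffeo f a b) : InjOn f (Icc a b) :=
  h.mono.elim StrictMonoOn.injOn StrictAntiOn.injOn

theorem restrict (h : CrossDiffeo f a b) (ha : a ≤ a') (hab : a' < b') (hb : b' ≤ b) :
    CrossDiffeo f a' b' where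
  lt := hab
  hasDeriv x hx := by
    obtain ⟨d, h0, hd⟩ := h.hasDeriv x (Icc_subset_Icc ha hb hx)
    exact ⟨d, h0, hd.mono (Icc_subset_Icc ha hb)⟩
  mono := h.mono.imp (fun h => h.mono (Icc_subset_Icc ha hb)) fun h => h.mono (Icc_subset_Icc ha hb)
  cross p x y q h1 h2 h3 h4 h5 := h.cross p x y q (ha.trans h1) h2 h3 h4 (h5.trans hb)

theorem congr (h : CrossDiffeo f a b) (e : EqOn g f (Icc a b)) : CrossDiffeo g a b where
  lt := h.lt
  hasDeriv x hx := by
    obtain ⟨d, h0, hd⟩ := h.hasDeriv x hx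
    exact ⟨d, h0, hd.congr e (e hx)⟩
  mono := h.mono.imp (fun h => h.congr e.symm) fun h => h.congr e.symm
  cross p x y q h1 h2 h3 h4 h5 := by
    rw [e ⟨h1, by linarith⟩, e ⟨h1.trans h2, by linarith⟩, e ⟨by linarith, h4.trans h5⟩,
      e ⟨by linarith, h5⟩]
    exact h.cross p x y q h1 h2 h3 h4 h5

theorem comp (hg : CrossDiffeo g a' b') (hf : CrossDiffeo f a b)
    (hm : MapsTo f (Icc a b) (Icc a' b')) : CrossDiffeo (g ∘ f) a b where
  lt := hf.lt
  hasDeriv x hx := by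
    obtain ⟨d, h0, hd⟩ := hf.hasDeriv x hx
    obtain ⟨e, h1, he⟩ := hg.hasDeriv (f x) (hm hx)
    exact ⟨e * d, mul_ne_zero h1 h0, he.comp x hd hm⟩
  mono := by
    rcases hf.mono with h | h <;> rcases hg.mono with h' | h'
    · exact Or.inl (h'.comp h hm)
    · exact Or.inr (h'.comp_strictMonoOn h hm)
    · exact Or.inr (h'.comp_strictAntiOn h hm)
    · exact Or.inl (h'.comp h hm)
  cross p x y q h1 h2 h3 h4 h5 := by
    have mp : p ∈ Icc a b := ⟨h1, by linarith⟩
    have mx : x ∈ Icc a b := ⟨by linarith, by linarith⟩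
    have my : y ∈ Icc a b := ⟨by linarith, by linarith⟩
    have mq : q ∈ Icc a b := ⟨by linarith, h5⟩
    rcases h2.eq_or_lt with rfl | h2
    · simp
    rcases h4.eq_or_lt with rfl | h4
    · simp
    have H1 := hf.cross p x y q h1 h2.le h3 h4.le h5
    -- Transitivity of B/A ≤ B1/A1 ≤ B2/A2 without division. Only the middle denominator must be
    -- positive, which is why `p = x` and `y = q` were treated separately.
    have key : ∀ A B A1 B1 A2 B2 : ℝ, 0 ≤ A → 0 < A1 → 0 ≤ A2 → B * A1 ≤ B1 * A →
        B1 * A2 ≤ B2 * A1 → B * A2 ≤ B2 * A := by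
      intro A B A1 B1 A2 B2 hA hA1 hA2 h1 h2
      refine le_of_mul_le_mul_right ?_ hA1
      calc B * A2 * A1 = B * A1 * A2 := by ring
        _ ≤ B1 * A * A2 := by gcongr
        _ = B1 * A2 * A := by ring
        _ ≤ B2 * A1 * A := by gcongr
        _ = B2 * A * A1 := by ring
    have hpos : ∀ {k : ℝ → ℝ} {s t u v}, (StrictMonoOn k (Icc s t) ∨ StrictAntiOn k (Icc s t)) →
        ∀ {m n : ℝ}, m ∈ Icc s t → n ∈ Icc s t → u ∈ Icc s t → v ∈ Icc s t → m < n → u < v →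
        0 < (k n - k m) * (k v - k u) := by
      rintro k s t u v (hk | hk) m n hm hn hu hv hmn huv
      · exact mul_pos (sub_pos.2 (hk hm hn hmn)) (sub_pos.2 (hk hu hv huv))
      · exact mul_pos_of_neg_of_neg (sub_neg.2 (hk hm hn hmn)) (sub_neg.2 (hk hu hv huv))
    have hA1 := hpos hf.mono mp mx my mq h2 h4
    refine key _ _ _ _ _ _ (mul_nonneg (by linarith) (by linarith)) hA1 ?_ H1 ?_
    · rcases hf.mono with h | h
      · exact (hpos hg.mono (hm mp) (hm mx) (hm my) (hm mq) (h mp mx h2) (h my mq h4)).le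
      -- A decreasing `f` reverses the order of the four points; the cross ratio is invariant under
      -- this reversal.
      · have := hpos hg.mono (hm mx) (hm mp) (hm mq) (hm my) (h mp mx h2) (h my mq h4)
        simp only [Function.comp_apply]
        linarith
    · rcases hf.mono with h | h
      · exact hg.cross _ _ _ _ (hm mp).1 (h mp mx h2).le (h.monotoneOn mx my h3) (h my mq h4).le
          (hm mq).2
      · have := hg.cross _ _ _ _ (hm mq).1 (h my mq h4).le (h.antitoneOn mx my h3)
          (h mp mx h2).le (hm mp).2
        simp only [Function.comp_apply]
        linarith

theorem sq_sub {c : ℝ} (hab : a < b) (hc : c < a ∨ b < c) :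
    CrossDiffeo (fun x => (x - c) ^ 2) a b where
  lt := hab
  hasDeriv x hx := by
    refine ⟨2 * (x - c), ?_, ?_⟩
    · have : x - c ≠ 0 := by
        rcases hc with h | h
        · linarith [hx.1]
        · linarith [hx.2]
      positivity
    · exact (((hasDerivAt_id' x).sub_const c).pow 2).hasDerivWithinAt.congr_deriv (by simp)
  mono := by
    rcases hc with h | h
    · left
      intro x hx y hy hxy
      simp only
      nlinarith [hx.1, hy.1]
    · right
      intro x hx y hy hxy
      simp only
      nlinarith [hx.2, hy.2]
  cross p x y q h1 h2 h3 h4 h5 := by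
    -- This product is exactly the difference of the two sides.
    have h : 0 ≤ (y - x) * (q - p) * ((x - p) * (q - y)) * ((q - x) * (y - p)) := by
      have : 0 ≤ y - x := by linarith
      have : 0 ≤ q - p := by linarith
      have : 0 ≤ x - p := by linarith
      have : 0 ≤ q - y := by linarith
      have : 0 ≤ q - x := by linarith
      have : 0 ≤ y - p := by linarith
      positivity
    linear_combination h

end CrossDiffeo

namespace CrossDiffeo

variable {f : ℝ → ℝ} {a b d₀ d₁ u : ℝ}

theorem endpoints (h : CrossDiffeo f a b) (hi : f '' Icc a b = Icc d₀ d₁) :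
    (f a = d₀ ∧ f b = d₁) ∨ (f a = d₁ ∧ f b = d₀) := by
  have hab := h.lt.le
  have hle : d₀ ≤ d₁ := by
    have : (f '' Icc a b).Nonempty := (nonempty_Icc.2 hab).image f
    rw [hi] at this
    exact nonempty_Icc.1 this
  obtain ⟨u, hu, hu'⟩ : d₀ ∈ f '' Icc a b := hi ▸ left_mem_Icc.2 hle
  obtain ⟨v, hv, hv'⟩ : d₁ ∈ f '' Icc a b := hi ▸ right_mem_Icc.2 hle
  have ma := left_mem_Icc.2 hab
  have mb := right_mem_Icc.2 hab
  have ha : f a ∈ Icc d₀ d₁ := hi ▸ mem_image_of_mem f ma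
  have hb : f b ∈ Icc d₀ d₁ := hi ▸ mem_image_of_mem f mb
  rcases h.mono with hm | hm
  · left
    have h1 := hm.monotoneOn ma hu hu.1
    have h2 := hm.monotoneOn hv mb hv.2
    exact ⟨le_antisymm (by linarith) ha.1, le_antisymm hb.2 (by linarith)⟩
  · right
    have h1 := hm.antitoneOn ma hv hv.1
    have h2 := hm.antitoneOn hu mb hu.2
    exact ⟨le_antisymm ha.2 (by linarith), le_antisymm (by linarith) hb.1⟩

/-- The preimage of an interval that avoids the images of the end points. -/
theorem preimage_inner (h : CrossDiffeo f a b) (hd : d₀ < d₁) (hu : u ∈ Icc a b)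
    (hfu : f u ∈ Icc d₀ d₁) (ha : f a ∉ Icc d₀ d₁) (hb : f b ∉ Icc d₀ d₁) :
    ∃ a' b', a < a' ∧ a' < b' ∧ b' < b ∧ {z ∈ Icc a b | f z ∈ Icc d₀ d₁} = Icc a' b' ∧
      f '' Icc a' b' = Icc d₀ d₁ := by
  have ma := left_mem_Icc.2 h.lt.le
  have mb := right_mem_Icc.2 h.lt.le
  have hc := h.continuousOn
  suffices H : ∃ a' b', a' ∈ Icc a b ∧ b' ∈ Icc a b ∧ a' < b' ∧
      {z ∈ Icc a b | f z ∈ Icc d₀ d₁} = Icc a' b' ∧ Icc d₀ d₁ ⊆ f '' Icc a b by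
    obtain ⟨a', b', ha', hb', hlt, he, hsub⟩ := H
    refine ⟨a', b', lt_of_le_of_ne ha'.1 ?_, hlt, lt_of_le_of_ne hb'.2 ?_, he, ?_⟩
    · rintro rfl
      have : a ∈ {z ∈ Icc a b | f z ∈ Icc d₀ d₁} := he ▸ left_mem_Icc.2 hlt.le
      exact ha this.2
    · rintro rfl
      have : b' ∈ {z ∈ Icc a b' | f z ∈ Icc d₀ d₁} := he ▸ right_mem_Icc.2 hlt.le
      exact hb this.2
    · rw [← he]
      ext w
      constructor
      · rintro ⟨z, hz, rfl⟩
        exact hz.2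
      · intro hw
        obtain ⟨z, hz, rfl⟩ := hsub hw
        exact ⟨z, ⟨hz, hw⟩, rfl⟩
  rcases h.mono with hm | hm
  · have h1 : f a < d₀ := by
      by_contra! hcon
      exact ha ⟨hcon, (hm.monotoneOn ma hu hu.1).trans hfu.2⟩
    have h2 : d₁ < f b := by
      by_contra! hcon
      exact hb ⟨hfu.1.trans (hm.monotoneOn hu mb hu.2), hcon⟩
    have hsub : Icc (f a) (f b) ⊆ f '' Icc a b := intermediate_value_Icc h.lt.le hc
    obtain ⟨a', ha', e0⟩ := hsub ⟨h1.le, by linarith⟩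
    obtain ⟨b', hb', e1⟩ := hsub ⟨by linarith, h2.le⟩
    refine ⟨a', b', ha', hb', (hm.lt_iff_lt ha' hb').1 (by rwa [e0, e1]), ?_,
      (Icc_subset_Icc h1.le h2.le).trans hsub⟩
    ext z
    constructor
    · rintro ⟨hz, hz1, hz2⟩
      rw [← e0] at hz1
      rw [← e1] at hz2
      exact ⟨(hm.le_iff_le ha' hz).1 hz1, (hm.le_iff_le hz hb').1 hz2⟩
    · rintro ⟨hz1, hz2⟩
      have hz : z ∈ Icc a b := ⟨ha'.1.trans hz1, hz2.trans hb'.2⟩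
      refine ⟨hz, ?_, ?_⟩
      · rw [← e0]; exact hm.monotoneOn ha' hz hz1
      · rw [← e1]; exact hm.monotoneOn hz hb' hz2
  · have h1 : d₁ < f a := by
      by_contra! hcon
      exact ha ⟨hfu.1.trans (hm.antitoneOn ma hu hu.1), hcon⟩
    have h2 : f b < d₀ := by
      by_contra! hcon
      exact hb ⟨hcon, (hm.antitoneOn hu mb hu.2).trans hfu.2⟩
    have hsub : Icc (f b) (f a) ⊆ f '' Icc a b := intermediate_value_Icc' h.lt.le hc
    obtain ⟨a', ha', e0⟩ := hsub ⟨by linarith, h1.le⟩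
    obtain ⟨b', hb', e1⟩ := hsub ⟨h2.le, by linarith⟩
    refine ⟨a', b', ha', hb', (hm.lt_iff_gt hb' ha').1 (by rwa [e0, e1]), ?_,
      (Icc_subset_Icc h2.le h1.le).trans hsub⟩
    ext z
    constructor
    · rintro ⟨hz, hz1, hz2⟩
      rw [← e1] at hz1
      rw [← e0] at hz2
      exact ⟨(hm.le_iff_ge hz ha').1 hz2, (hm.le_iff_ge hb' hz).1 hz1⟩
    · rintro ⟨hz1, hz2⟩
      have hz : z ∈ Icc a b := ⟨ha'.1.trans hz1, hz2.trans hb'.2⟩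
      refine ⟨hz, ?_, ?_⟩
      · rw [← e1]; exact hm.antitoneOn hz hb' hz2
      · rw [← e0]; exact hm.antitoneOn ha' hz hz1

/-- The preimage of an interval that contains the image of the left end point only. -/
theorem preimage_left (h : CrossDiffeo f a b)
    (ha : f a ∈ Icc d₀ d₁) (hb : f b ∉ Icc d₀ d₁) :
    ∃ t, a ≤ t ∧ t < b ∧ {z ∈ Icc a b | f z ∈ Icc d₀ d₁} = Icc a t ∧ (f t = d₀ ∨ f t = d₁) := by
  have ma := left_mem_Icc.2 h.lt.le
  have mb := right_mem_Icc.2 h.lt.le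
  suffices H : ∃ t ∈ Icc a b, {z ∈ Icc a b | f z ∈ Icc d₀ d₁} = Icc a t ∧
      (f t = d₀ ∨ f t = d₁) by
    obtain ⟨t, ht, he, hft⟩ := H
    refine ⟨t, ht.1, lt_of_le_of_ne ht.2 ?_, he, hft⟩
    intro e
    have : b ∈ {z ∈ Icc a b | f z ∈ Icc d₀ d₁} := by
      rw [he, e]
      exact right_mem_Icc.2 h.lt.le
    exact hb this.2
  rcases h.mono with hm | hm
  · have h2 : d₁ < f b := by
      by_contra! hcon
      exact hb ⟨ha.1.trans (hm.monotoneOn ma mb h.lt.le), hcon⟩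
    obtain ⟨t, ht, e⟩ := intermediate_value_Icc h.lt.le h.continuousOn ⟨ha.2, h2.le⟩
    refine ⟨t, ht, ?_, Or.inr e⟩
    ext z
    constructor
    · rintro ⟨hz, -, hz2⟩
      rw [← e] at hz2
      exact ⟨hz.1, (hm.le_iff_le hz ht).1 hz2⟩
    · rintro ⟨hz1, hz2⟩
      have hz : z ∈ Icc a b := ⟨hz1, hz2.trans ht.2⟩
      refine ⟨hz, ha.1.trans (hm.monotoneOn ma hz hz1), ?_⟩
      rw [← e]; exact hm.monotoneOn hz ht hz2
  · have h2 : f b < d₀ := by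
      by_contra! hcon
      exact hb ⟨hcon, (hm.antitoneOn ma mb h.lt.le).trans ha.2⟩
    obtain ⟨t, ht, e⟩ := intermediate_value_Icc' h.lt.le h.continuousOn ⟨h2.le, ha.1⟩
    refine ⟨t, ht, ?_, Or.inl e⟩
    ext z
    constructor
    · rintro ⟨hz, hz1, -⟩
      rw [← e] at hz1
      exact ⟨hz.1, (hm.le_iff_ge ht hz).1 hz1⟩
    · rintro ⟨hz1, hz2⟩
      have hz : z ∈ Icc a b := ⟨hz1, hz2.trans ht.2⟩
      refine ⟨hz, ?_, (hm.antitoneOn ma hz hz1).trans ha.2⟩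
      rw [← e]; exact hm.antitoneOn hz ht hz2

theorem id (hab : a < b) : CrossDiffeo (fun x => x) a b where
  lt := hab
  hasDeriv x _ := ⟨1, one_ne_zero, hasDerivWithinAt_id x _⟩
  mono := Or.inl strictMonoOn_id
  cross _ _ _ _ _ _ _ _ _ := le_rfl

end CrossDiffeo

/-! ### Box maps of quadratic type and the pieces of their first return maps. -/

/-- The central branch `h ∘ φ` over the interval `K = [c - r, c + r]`, carrying `∂K` into `∂J`. -/
def IsFold (c : ℝ) (f : ℝ → ℝ) (K J : Seg) : Prop :=
  ∃ r > 0, K.fst = c - r ∧ K.snd = c + r ∧ ∃ h : ℝ → ℝ, CrossDiffeo h 0 (r ^ 2) ∧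
    (∀ x ∈ pts K, f x = h ((x - c) ^ 2)) ∧ h 0 ∈ pts J ∧ (h (r ^ 2) = J.fst ∨ h (r ^ 2) = J.snd)

/-- The properties of the maps of class `𝒯` that are inherited by pre-renormalizations. -/
structure QuadBox (c : ℝ) (G : RMap) : Prop where
  nondeg : ∀ K ∈ G.pieces, K.fst < K.snd
  interior : ∀ K ∈ G.pieces, G.J.fst < K.fst ∧ K.snd < G.J.snd
  disjoint : ∀ K ∈ G.pieces, ∀ K' ∈ G.pieces, K ≠ K' → Disjoint (pts K) (pts K')
  noncentral : ∀ K ∈ G.pieces, c ∉ pts K →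
    CrossDiffeo G.g K.fst K.snd ∧ G.g '' pts K = pts G.J
  mem : centralPiece c G ∈ G.pieces
  central : IsFold c G.g (centralPiece c G) G.J

theorem eq_of_mem_pts {G : RMap}
    (hd : ∀ K ∈ G.pieces, ∀ K' ∈ G.pieces, K ≠ K' → Disjoint (pts K) (pts K')) {K K' : Seg}
    (hK : K ∈ G.pieces) (hK' : K' ∈ G.pieces) {x : ℝ} (hx : x ∈ pts K) (hx' : x ∈ pts K') :
    K = K' := by
  by_contra h
  exact Set.disjoint_left.1 (hd K hK K' hK' h) hx hx'

theorem centralPiece_eq {c : ℝ} {G : RMap}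
    (hd : ∀ K ∈ G.pieces, ∀ K' ∈ G.pieces, K ≠ K' → Disjoint (pts K) (pts K')) {K : Seg}
    (hK : K ∈ G.pieces) (hc : c ∈ pts K) : centralPiece c G = K := by
  have h : ∃ K ∈ G.pieces, c ∈ pts K := ⟨K, hK, hc⟩
  rw [centralPiece, dif_pos h]
  exact eq_of_mem_pts hd h.choose_spec.1 hK h.choose_spec.2 hc

theorem mem_pts_of_radius {c r : ℝ} {K : Seg} (hr : 0 < r) (h1 : K.fst = c - r)
    (h2 : K.snd = c + r) : c ∈ pts K := ⟨by linarith, by linarith⟩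

theorem IsFold.mem {c : ℝ} {f : ℝ → ℝ} {K J : Seg} (h : IsFold c f K J) : c ∈ pts K := by
  obtain ⟨r, hr, h1, h2, -⟩ := h
  exact mem_pts_of_radius hr h1 h2

theorem ClassT.quadBox {c : ℝ} {G : RMap} (h : ClassT c G) : QuadBox c G := by
  obtain ⟨K, hK, r, hr, h1, h2, f, hf, hg, h0, he⟩ := h.central
  have e := centralPiece_eq h.disjoint hK (mem_pts_of_radius hr h1 h2)
  exact {
    nondeg := h.nondeg
    interior := h.interior
    disjoint := h.disjoint
    noncentral := fun K hK hc =>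
      ⟨(h.noncentral K hK hc).1.crossDiffeo (h.nondeg K hK), (h.noncentral K hK hc).2⟩
    mem := e ▸ hK
    central := e ▸ ⟨r, hr, h1, h2, f, hf.crossDiffeo (by positivity), hg, h0, he⟩ }

/-- The points that follow the itinerary of `y` through non-central pieces during the first `m`
iterates and then are in the central piece. -/
def cylinder (c : ℝ) (G : RMap) (m : ℕ) (y : ℝ) : Set ℝ :=
  {z | (∀ i < m, ∃ K ∈ G.pieces, c ∉ pts K ∧ G.g^[i] y ∈ pts K ∧ G.g^[i] z ∈ pts K) ∧
    G.g^[m] z ∈ pts (centralPiece c G)}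

namespace QuadBox

variable {c : ℝ} {G : RMap}

theorem not_mem_of_mem_J_boundary (hG : QuadBox c G) {x : ℝ} (hx : x = G.J.fst ∨ x = G.J.snd)
    {K : Seg} (hK : K ∈ G.pieces) : x ∉ pts K := by
  rintro ⟨h1, h2⟩
  have := hG.interior K hK
  rcases hx with rfl | rfl <;> linarith

theorem eq_centralPiece (hG : QuadBox c G) {K : Seg} (hK : K ∈ G.pieces) (hc : c ∈ pts K) :
    centralPiece c G = K := centralPiece_eq hG.disjoint hK hc

theorem not_mem_central (hG : QuadBox c G) {K : Seg} (hK : K ∈ G.pieces) (hc : c ∉ pts K) {x : ℝ}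
    (hx : x ∈ pts K) : x ∉ pts (centralPiece c G) := by
  intro h
  have := eq_of_mem_pts hG.disjoint hK hG.mem hx h
  exact hc (this ▸ hG.central.mem)

theorem boundary_maps (hG : QuadBox c G) {x : ℝ}
    (hx : x = (centralPiece c G).fst ∨ x = (centralPiece c G).snd) :
    G.g x = G.J.fst ∨ G.g x = G.J.snd := by
  obtain ⟨r, hr, h1, h2, h, hh, hg, h0, he⟩ := hG.central
  have hx' : x ∈ pts (centralPiece c G) := by
    rcases hx with rfl | rfl
    · exact ⟨le_rfl, by linarith⟩
    · exact ⟨by linarith, le_rfl⟩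
  rw [hg x hx']
  have : (x - c) ^ 2 = r ^ 2 := by
    rcases hx with rfl | rfl
    · rw [h1]; ring
    · rw [h2]; ring
  rwa [this]

/-- Induction by peeling off the first iterate: the cylinder of `y` is the preimage, under one
branch onto `J`, of the cylinder of `G.g y`. That cylinder lies in the interior of `J`, and the end
points of the branch go to ∂J, so its full preimage is an interval inside the piece. -/
theorem cylinder_eq (hG : QuadBox c G) (m : ℕ) (y : ℝ) (hy : y ∈ cylinder c G m y) :
    ∃ D : Seg, pts D = cylinder c G m y ∧ CrossDiffeo G.g^[m] D.fst D.snd ∧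
      G.g^[m] '' pts D = pts (centralPiece c G) ∧ G.J.fst < D.fst ∧ D.snd < G.J.snd := by
  induction m generalizing y with
  | zero =>
    refine ⟨centralPiece c G, ?_, ?_, ?_, hG.interior _ hG.mem⟩
    · ext z; simp [cylinder]
    · exact CrossDiffeo.id (hG.nondeg _ hG.mem)
    · simp
  | succ m ih =>
    obtain ⟨K, hK, hcK, hyK, -⟩ := hy.1 0 (by omega)
    simp only [Function.iterate_zero, _root_.id] at hyK
    obtain ⟨D, hD, hDc, hDi, hD0, hD1⟩ := ih (G.g y) ⟨fun i hi => by
      simpa only [Function.iterate_succ_apply] using hy.1 (i + 1) (by omega), by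
      simpa only [Function.iterate_succ_apply] using hy.2⟩
    have hcyl : cylinder c G (m + 1) y = {z ∈ pts K | G.g z ∈ pts D} := by
      ext z
      rw [hD]
      constructor
      · rintro ⟨h1, h2⟩
        refine ⟨?_, fun i hi => ?_, ?_⟩
        · obtain ⟨K', hK', -, hyK', hzK'⟩ := h1 0 (by omega)
          simp only [Function.iterate_zero, _root_.id] at hyK' hzK'
          rwa [eq_of_mem_pts hG.disjoint hK hK' hyK hyK']
        · simpa only [Function.iterate_succ_apply] using h1 (i + 1) (by omega)
        · simpa only [Function.iterate_succ_apply] using h2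
      · rintro ⟨h1, h2, h3⟩
        refine ⟨fun i hi => ?_, ?_⟩
        · rcases i with _ | i
          · exact ⟨K, hK, hcK, hyK, h1⟩
          · simpa only [Function.iterate_succ_apply] using h2 i (by omega)
        · simpa only [Function.iterate_succ_apply] using h3
    have hyS : y ∈ {z ∈ pts K | G.g z ∈ pts D} := hcyl ▸ hy
    obtain ⟨hf, hfi⟩ := hG.noncentral K hK hcK
    have hend := hf.endpoints hfi
    have hout : ∀ w, (w = G.J.fst ∨ w = G.J.snd) → w ∉ Icc D.fst D.snd := by
      rintro w hw ⟨h1, h2⟩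
      rcases hw with rfl | rfl <;> linarith
    obtain ⟨a, b, ha, hab, hb, hS, him⟩ := hf.preimage_inner hDc.lt hyS.1 hyS.2
      (hout _ (by tauto)) (hout _ (by tauto))
    have hJ := hG.interior K hK
    refine ⟨⟨⟨a, b⟩, hab.le⟩, ?_, ?_, ?_, hJ.1.trans ha, hb.trans hJ.2⟩
    · rw [hcyl]; exact hS.symm
    · rw [Function.iterate_succ]
      exact hDc.comp (hf.restrict ha.le hab hb.le) fun z hz => him ▸ mem_image_of_mem _ hz
    · rw [Function.iterate_succ, image_comp]
      change G.g^[m] '' (G.g '' Icc a b) = _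
      rw [him]; exact hDi

theorem returnTime_eq (hG : QuadBox c G) {k : ℕ} {K : Seg} (h : IsReturnSeg c G k K) {z : ℝ}
    (hz : z ∈ pts K) : returnTime c G z = k := by
  have hk : k ∈ {k : ℕ | 1 ≤ k ∧ G.g^[k] z ∈ pts (centralPiece c G)} :=
    ⟨h.1, h.2.2.2 (mem_image_of_mem _ hz)⟩
  refine le_antisymm (Nat.sInf_le hk) ?_
  by_contra! hlt
  have hm := Nat.sInf_mem ⟨k, hk⟩
  obtain ⟨K', hK', hc, hsub⟩ := h.2.2.1 (returnTime c G z) hm.1 hlt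
  exact hG.not_mem_central hK' hc (hsub (mem_image_of_mem _ hz)) hm.2

/-- Return segments through a common point share the return time and, by disjointness of the pieces,
the itinerary. Their hull is then a return segment too, and maximality makes both equal to it. -/
theorem maximal_eq (hG : QuadBox c G) {k k' : ℕ} {K K' : Seg}
    (h : Maximal (IsReturnSeg c G k) K) (h' : Maximal (IsReturnSeg c G k') K') {z : ℝ}
    (hz : z ∈ pts K) (hz' : z ∈ pts K') : K = K' := by
  obtain rfl : k = k' := (hG.returnTime_eq h.prop hz).symm.trans (hG.returnTime_eq h'.prop hz')
  set L : Seg := ⟨⟨min K.fst K'.fst, max K.snd K'.snd⟩,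
    (min_le_left _ _).trans (K.fst_le_snd.trans (le_max_left _ _))⟩ with hL
  have hLs : pts L ⊆ pts K ∪ pts K' := by
    rintro w ⟨h1, h2⟩
    simp only [hL, min_le_iff, le_max_iff] at h1 h2
    simp only [pts, mem_union, mem_Icc] at hz hz' ⊢
    rcases le_total w z with h3 | h3
    · rcases h1 with h1 | h1
      · exact Or.inl ⟨h1, by linarith⟩
      · exact Or.inr ⟨h1, by linarith⟩
    · rcases h2 with h2 | h2
      · exact Or.inl ⟨by linarith, h2⟩
      · exact Or.inr ⟨by linarith, h2⟩
  have hLr : IsReturnSeg c G k L := by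
    refine ⟨h.prop.1, hLs.trans (union_subset h.prop.2.1 h'.prop.2.1), fun i hi hik => ?_, ?_⟩
    · obtain ⟨A, hA, hcA, hsA⟩ := h.prop.2.2.1 i hi hik
      obtain ⟨B, hB, -, hsB⟩ := h'.prop.2.2.1 i hi hik
      obtain rfl : A = B := eq_of_mem_pts hG.disjoint hA hB (hsA (mem_image_of_mem _ hz))
        (hsB (mem_image_of_mem _ hz'))
      refine ⟨A, hA, hcA, (image_mono hLs).trans ?_⟩
      rw [image_union]
      exact union_subset hsA hsB
    · refine (image_mono hLs).trans ?_
      rw [image_union]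
      exact union_subset h.prop.2.2.2 h'.prop.2.2.2
  have hKL : K ≤ L := ⟨min_le_left _ _, le_max_left _ _⟩
  have hKL' : K' ≤ L := ⟨min_le_right _ _, le_max_right _ _⟩
  exact (h.eq_of_le hLr hKL).trans (h'.eq_of_le hLr hKL').symm

end QuadBox
namespace QuadBox

variable {c : ℝ} {G : RMap}

/-- The component of the domain of the first return map that contains the point `x`. -/
theorem exists_return_piece (hG : QuadBox c G) (hA : ∀ m, ∃ K ∈ G.pieces, G.g^[m] c ∈ pts K)
    {s k : ℕ} {x : ℝ} (hxs : G.g^[s] c = x) (hx : x ∈ pts (centralPiece c G)) (hk : 1 ≤ k)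
    (hret : G.g^[k] x ∈ pts (centralPiece c G))
    (hfirst : ∀ i, 1 ≤ i → i < k → G.g^[i] x ∉ pts (centralPiece c G)) :
    ∃ K, Maximal (IsReturnSeg c G k) K ∧ x ∈ pts K ∧ K.fst < K.snd ∧
      (centralPiece c G).fst < K.fst ∧ K.snd < (centralPiece c G).snd ∧
      (c ∈ pts K → IsFold c G.g^[k] K (centralPiece c G)) ∧
      (c ∉ pts K → CrossDiffeo G.g^[k] K.fst K.snd ∧
        G.g^[k] '' pts K = pts (centralPiece c G)) := by
  obtain ⟨m, rfl⟩ : ∃ m, k = m + 1 := ⟨k - 1, by omega⟩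
  have horb : ∀ i, ∃ K ∈ G.pieces, G.g^[i] x ∈ pts K := by
    intro i
    rw [← hxs, ← Function.iterate_add_apply]
    exact hA _
  have hy : G.g x ∈ cylinder c G m (G.g x) := by
    refine ⟨fun i hi => ?_, by rwa [← Function.iterate_succ_apply]⟩
    obtain ⟨K, hK, hxK⟩ := horb (i + 1)
    have hcK : c ∉ pts K := fun hcK =>
      hfirst (i + 1) (by omega) (by omega) (hG.eq_centralPiece hK hcK ▸ hxK)
    rw [Function.iterate_succ_apply] at hxK
    exact ⟨K, hK, hcK, hxK, hxK⟩
  obtain ⟨D, hD, hDc, hDi, hD0, hD1⟩ := hG.cylinder_eq m _ hy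
  -- `S` collects all points of the central piece that return with the itinerary of `x`. The return
  -- piece sought is the component of `S` containing `x`.
  set S : Set ℝ := {z ∈ pts (centralPiece c G) | G.g z ∈ pts D} with hS
  have hxS : x ∈ S := ⟨hx, hD ▸ hy⟩
  have hretS : ∀ K : Seg, x ∈ pts K → (IsReturnSeg c G (m + 1) K ↔ pts K ⊆ S) := by
    intro K hxK
    constructor
    · intro h z hz
      refine ⟨h.2.1 hz, ?_⟩
      rw [hD]
      refine ⟨fun i hi => ?_, ?_⟩
      · obtain ⟨K', hK', hcK', hsub⟩ := h.2.2.1 (i + 1) (by omega) (by omega)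
        simp only [← Function.iterate_succ_apply]
        exact ⟨K', hK', hcK', hsub (mem_image_of_mem _ hxK), hsub (mem_image_of_mem _ hz)⟩
      · rw [← Function.iterate_succ_apply]
        exact h.2.2.2 (mem_image_of_mem _ hz)
    · intro h
      refine ⟨by omega, fun z hz => (h hz).1, fun i hi him => ?_, ?_⟩
      · obtain ⟨i, rfl⟩ : ∃ j, i = j + 1 := ⟨i - 1, by omega⟩
        obtain ⟨K', hK', hcK', hxK', -⟩ := hy.1 i (by omega)
        refine ⟨K', hK', hcK', ?_⟩
        rintro _ ⟨z, hz, rfl⟩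
        have hz' : G.g z ∈ cylinder c G m (G.g x) := hD ▸ (h hz).2
        obtain ⟨K'', hK'', -, hxK'', hzK''⟩ := hz'.1 i (by omega)
        rw [Function.iterate_succ_apply, eq_of_mem_pts hG.disjoint hK' hK'' hxK' hxK'']
        exact hzK''
      · rintro _ ⟨z, hz, rfl⟩
        have hz' : G.g z ∈ cylinder c G m (G.g x) := hD ▸ (h hz).2
        rw [Function.iterate_succ_apply]
        exact hz'.2
  have hmax : ∀ K : Seg, x ∈ pts K → pts K ⊆ S →
      (∀ K' : Seg, x ∈ pts K' → pts K' ⊆ S → K' ≤ K) →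
      Maximal (IsReturnSeg c G (m + 1)) K := by
    intro K hxK hKS h
    refine ⟨(hretS K hxK).2 hKS, fun K' hK' hle => ?_⟩
    have hxK' : x ∈ pts K' := ⟨hle.1.trans hxK.1, hxK.2.trans hle.2⟩
    exact h K' hxK' ((hretS K' hxK').1 hK')
  obtain ⟨r, hr, hI0, hI1, h, hh, hgh, hh0, hhr⟩ := hG.central
  have hI : ∀ z, z ∈ pts (centralPiece c G) ↔ (z - c) ^ 2 ∈ Icc 0 (r ^ 2) := by
    intro z
    rw [pts, hI0, hI1, mem_Icc, mem_Icc]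
    constructor
    · rintro ⟨h1, h2⟩
      exact ⟨sq_nonneg _, sq_le_sq' (by linarith) (by linarith)⟩
    · rintro ⟨-, h2⟩
      have := abs_le_of_sq_le_sq' h2 hr.le
      exact ⟨by linarith [this.1], by linarith [this.2]⟩
  -- In the coordinate (z - c)² the set `S` becomes the preimage of an interval under the monotone
  -- map `h`.
  have hSiff : ∀ z, z ∈ S ↔ (z - c) ^ 2 ∈ {u ∈ Icc 0 (r ^ 2) | h u ∈ Icc D.fst D.snd} := by
    intro z
    constructor
    · rintro ⟨h1, h2⟩
      rw [hgh z h1] at h2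
      exact ⟨(hI z).1 h1, h2⟩
    · rintro ⟨h1, h2⟩
      have h1 := (hI z).2 h1
      exact ⟨h1, by rw [hgh z h1]; exact h2⟩
  have hout : h (r ^ 2) ∉ Icc D.fst D.snd := by
    rintro ⟨h1, h2⟩
    rcases hhr with h | h <;> linarith
  have hiter : ∀ z ∈ pts (centralPiece c G), G.g^[m + 1] z = (G.g^[m] ∘ h) ((z - c) ^ 2) := by
    intro z hz
    rw [Function.iterate_succ_apply, hgh z hz, Function.comp_apply]
  -- Either `S` contains `c` and is one symmetric interval, giving a fold, or it has two
  -- mirror-image components, giving a diffeomorphic branch.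
  by_cases hcD : h 0 ∈ Icc D.fst D.snd
  · obtain ⟨t, ht0, htr, hset, hht⟩ := hh.preimage_left hcD hout
    rw [hset] at hSiff
    have hend := hDc.endpoints hDi
    -- If `t = 0`, then `c` would return to an end point of the central piece. The next iterate
    -- would lie on ∂J, outside all pieces, although every iterate of `c` is defined.
    have htpos : 0 < t := by
      refine lt_of_le_of_ne ht0 ?_
      rintro rfl
      have hc : c ∈ pts (centralPiece c G) := hG.central.mem
      have h1 : G.g^[m + 1] c = (centralPiece c G).fst ∨
          G.g^[m + 1] c = (centralPiece c G).snd := by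
        rw [hiter c hc, sub_self, zero_pow two_ne_zero, Function.comp_apply]
        rcases hht with e | e <;> rw [e] <;> tauto
      have h2 := hG.boundary_maps h1
      obtain ⟨K, hK, hKm⟩ := hA (m + 2)
      rw [Function.iterate_succ_apply'] at hKm
      exact hG.not_mem_of_mem_J_boundary h2 hK hKm
    obtain ⟨σ, hσ, rfl⟩ : ∃ σ, 0 < σ ∧ t = σ ^ 2 :=
      ⟨√t, Real.sqrt_pos.2 htpos, (Real.sq_sqrt ht0).symm⟩
    have hσr : σ < r := lt_of_pow_lt_pow_left₀ 2 hr.le htr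
    have hSσ : S = Icc (c - σ) (c + σ) := by
      ext z
      rw [hSiff, mem_Icc, mem_Icc]
      constructor
      · rintro ⟨-, h2⟩
        have := abs_le_of_sq_le_sq' h2 hσ.le
        exact ⟨by linarith [this.1], by linarith [this.2]⟩
      · rintro ⟨h1, h2⟩
        exact ⟨sq_nonneg _, sq_le_sq' (by linarith) (by linarith)⟩
    have hmaps : MapsTo h (Icc 0 (σ ^ 2)) (Icc D.fst D.snd) := by
      intro u hu
      rw [← hset] at hu
      exact hu.2
    refine ⟨⟨⟨c - σ, c + σ⟩, by change c - σ ≤ c + σ; linarith⟩,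
      hmax _ ?_ ?_ ?_, ?_, ?_, ?_, ?_, ?_, ?_⟩
    · exact hSσ.le hxS
    · exact hSσ.ge
    · intro K' _ hK'
      rw [hSσ] at hK'
      exact ⟨(hK' (left_mem_Icc.2 K'.fst_le_snd)).1, (hK' (right_mem_Icc.2 K'.fst_le_snd)).2⟩
    · exact hSσ.le hxS
    · change c - σ < c + σ
      linarith
    · rw [hI0]; change c - r < c - σ; linarith
    · rw [hI1]; change c + σ < c + r; linarith
    · intro _
      refine ⟨σ, hσ, rfl, rfl, G.g^[m] ∘ h, hDc.comp (hh.restrict le_rfl htpos htr.le) hmaps,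
        fun z hz => ?_, ?_, ?_⟩
      · have hz' : z ∈ S := hSσ ▸ hz
        exact hiter z hz'.1
      · rw [← hDi]
        exact mem_image_of_mem _ (hmaps (left_mem_Icc.2 ht0))
      · rw [Function.comp_apply]
        rcases hht with e | e <;> rw [e] <;> tauto
    · intro hc
      exact absurd (mem_pts_of_radius hσ rfl rfl) hc
  · have hxS' := (hSiff x).1 hxS
    obtain ⟨t₁, t₂, ht₁, ht₁₂, ht₂, hset, him⟩ :=
      hh.preimage_inner hDc.lt hxS'.1 hxS'.2 hcD hout
    rw [hset] at hSiff
    have hcS : c ∉ S := by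
      rw [hSiff, sub_self]
      rintro ⟨h1, -⟩
      norm_num at h1
      linarith
    obtain ⟨σ, hσ, rfl⟩ : ∃ σ, 0 < σ ∧ t₁ = σ ^ 2 :=
      ⟨√t₁, Real.sqrt_pos.2 ht₁, (Real.sq_sqrt ht₁.le).symm⟩
    obtain ⟨τ, hτ, rfl⟩ : ∃ τ, 0 < τ ∧ t₂ = τ ^ 2 :=
      ⟨√t₂, Real.sqrt_pos.2 (ht₁.trans ht₁₂), (Real.sq_sqrt (ht₁.trans ht₁₂).le).symm⟩
    have hστ : σ < τ := lt_of_pow_lt_pow_left₀ 2 hτ.le ht₁₂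
    have hτr : τ < r := lt_of_pow_lt_pow_left₀ 2 hr.le ht₂
    have hcd : CrossDiffeo (G.g^[m] ∘ h) (σ ^ 2) (τ ^ 2) :=
      hDc.comp (hh.restrict ht₁.le ht₁₂ ht₂.le) fun u hu => him ▸ mem_image_of_mem _ hu
    have hcdi : (G.g^[m] ∘ h) '' Icc (σ ^ 2) (τ ^ 2) = pts (centralPiece c G) := by
      rw [image_comp, him]; exact hDi
    -- Common end of the argument for the component of `S` left or right of `c`. The condition `c <
    -- z ↔ c < x` selects the side of `x`.
    have finish : ∀ a b : ℝ, a < b → c - r < a → b < c + r → (c < a ∨ b < c) → x ∈ Icc a b →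
        (∀ z, z ∈ Icc a b → z ∈ S) → (∀ z, z ∈ S → (c < z ↔ c < x) → z ∈ Icc a b) →
        (fun z => (z - c) ^ 2) '' Icc a b = Icc (σ ^ 2) (τ ^ 2) →
        ∃ K, Maximal (IsReturnSeg c G (m + 1)) K ∧ x ∈ pts K ∧ K.fst < K.snd ∧
          (centralPiece c G).fst < K.fst ∧ K.snd < (centralPiece c G).snd ∧
          (c ∈ pts K → IsFold c G.g^[m + 1] K (centralPiece c G)) ∧
          (c ∉ pts K → CrossDiffeo G.g^[m + 1] K.fst K.snd ∧
            G.g^[m + 1] '' pts K = pts (centralPiece c G)) := by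
      intro a b hab har hbr hcab hxab hsub hsup himg
      refine ⟨⟨⟨a, b⟩, hab.le⟩, hmax _ hxab hsub ?_, hxab, hab, by rwa [hI0], by rwa [hI1], ?_, ?_⟩
      · intro K' hxK' hK'
        have hsame : ∀ z ∈ pts K', z ∈ Icc a b := by
          intro z hz
          refine hsup z (hK' hz) ?_
          have hcK' : c ∉ pts K' := fun h => hcS (hK' h)
          have : c < K'.fst ∨ K'.snd < c := by
            by_contra! hcon
            exact hcK' hcon
          rcases this with h | h
          · exact iff_of_true (h.trans_le hz.1) (h.trans_le hxK'.1)
          · exact iff_of_false (by linarith [hz.2]) (by linarith [hxK'.2])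
        exact ⟨(hsame _ (left_mem_Icc.2 K'.fst_le_snd)).1,
          (hsame _ (right_mem_Icc.2 K'.fst_le_snd)).2⟩
      · exact fun hc => absurd (hsub c hc) hcS
      · intro _
        have heq : EqOn G.g^[m + 1] ((G.g^[m] ∘ h) ∘ fun z => (z - c) ^ 2) (Icc a b) :=
          fun z hz => hiter z (hsub z hz).1
        refine ⟨(hcd.comp (CrossDiffeo.sq_sub hab hcab)
          fun z hz => himg ▸ mem_image_of_mem _ hz).congr heq, ?_⟩
        change G.g^[m + 1] '' Icc a b = _
        rw [heq.image_eq, image_comp, himg, hcdi]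
    have hxσ := (hSiff x).1 hxS
    rcases le_or_gt x c with hxc | hxc
    -- The case `x = c` does not need separate treatment, since `c ∉ S`.
    · refine finish (c - τ) (c - σ) (by linarith) (by linarith) (by linarith)
        (Or.inr (by linarith)) ?_ ?_ ?_ ?_
      · have h1 := abs_le_of_sq_le_sq' (a := c - x) (b := τ) (by nlinarith [hxσ.2]) hτ.le
        have h2 := le_of_sq_le_sq (a := σ) (b := c - x) (by nlinarith [hxσ.1]) (by linarith)
        exact ⟨by linarith [h1.2], by linarith⟩
      · rintro z ⟨h1, h2⟩
        rw [hSiff]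
        exact ⟨by nlinarith, by nlinarith⟩
      · intro z hz hzx
        have hzc : z ≤ c := not_lt.1 fun h => by linarith [hzx.1 h]
        have hz' := (hSiff z).1 hz
        have h1 := abs_le_of_sq_le_sq' (a := c - z) (b := τ) (by nlinarith [hz'.2]) hτ.le
        have h2 := le_of_sq_le_sq (a := σ) (b := c - z) (by nlinarith [hz'.1]) (by linarith)
        exact ⟨by linarith [h1.2], by linarith⟩
      · ext u
        constructor
        · rintro ⟨z, ⟨h1, h2⟩, rfl⟩
          exact ⟨by simp only; nlinarith, by simp only; nlinarith⟩
        · rintro ⟨h1, h2⟩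
          have h0 : 0 ≤ u := ht₁.le.trans h1
          refine ⟨c - √u, ⟨?_, ?_⟩, ?_⟩
          · have := Real.sqrt_le_iff.2 ⟨hτ.le, h2⟩
            linarith
          · have := Real.le_sqrt_of_sq_le h1
            linarith
          · simp only [sub_sub_cancel_left, neg_sq]
            exact Real.sq_sqrt h0
    · refine finish (c + σ) (c + τ) (by linarith) (by linarith) (by linarith)
        (Or.inl (by linarith)) ?_ ?_ ?_ ?_
      · have h1 := abs_le_of_sq_le_sq' hxσ.2 hτ.le
        have h2 := le_of_sq_le_sq hxσ.1 (by linarith)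
        exact ⟨by linarith, by linarith [h1.2]⟩
      · rintro z ⟨h1, h2⟩
        rw [hSiff]
        exact ⟨by nlinarith, by nlinarith⟩
      · intro z hz hzx
        have hzc : c < z := hzx.2 hxc
        have hz' := (hSiff z).1 hz
        have h1 := abs_le_of_sq_le_sq' hz'.2 hτ.le
        have h2 := le_of_sq_le_sq hz'.1 (by linarith)
        exact ⟨by linarith, by linarith [h1.2]⟩
      · ext u
        constructor
        · rintro ⟨z, ⟨h1, h2⟩, rfl⟩
          exact ⟨by simp only; nlinarith, by simp only; nlinarith⟩
        · rintro ⟨h1, h2⟩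
          have h0 : 0 ≤ u := ht₁.le.trans h1
          refine ⟨c + √u, ⟨?_, ?_⟩, ?_⟩
          · have := Real.le_sqrt_of_sq_le h1
            linarith
          · have := Real.sqrt_le_iff.2 ⟨hτ.le, h2⟩
            linarith
          · simp only [add_sub_cancel_left]
            exact Real.sq_sqrt h0

theorem central_mem_nhds (hG : QuadBox c G) : pts (centralPiece c G) ∈ nhds c := by
  obtain ⟨r, hr, h1, h2, -⟩ := hG.central
  exact Icc_mem_nhds (by linarith) (by linarith)

theorem returnTime_spec (hG : QuadBox c G) (hR : Recurrent c G) (s : ℕ) :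
    1 ≤ returnTime c G (G.g^[s] c) ∧
      G.g^[returnTime c G (G.g^[s] c)] (G.g^[s] c) ∈ pts (centralPiece c G) := by
  have h := Filter.frequently_atTop.1
    (mapClusterPt_iff_frequently.1 hR.2 _ hG.central_mem_nhds) (s + 1)
  obtain ⟨m, hm, hmem⟩ := h
  refine Nat.sInf_mem (s := {k : ℕ | 1 ≤ k ∧ G.g^[k] (G.g^[s] c) ∈ pts (centralPiece c G)})
    ⟨m - s, by omega, ?_⟩
  rw [← Function.iterate_add_apply, Nat.sub_add_cancel (by omega)]
  exact hmem

theorem exists_preRenorm_piece (hG : QuadBox c G) (hR : Recurrent c G) {s : ℕ}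
    (hs : G.g^[s] c ∈ pts (centralPiece c G)) :
    ∃ k K, Maximal (IsReturnSeg c G k) K ∧ G.g^[s] c ∈ pts K ∧ K ∈ (preRenorm c G).pieces ∧
      K.fst < K.snd ∧
      (centralPiece c G).fst < K.fst ∧ K.snd < (centralPiece c G).snd ∧
      (c ∈ pts K → IsFold c G.g^[k] K (centralPiece c G)) ∧
      (c ∉ pts K → CrossDiffeo G.g^[k] K.fst K.snd ∧
        G.g^[k] '' pts K = pts (centralPiece c G)) := by
  obtain ⟨h1, h2⟩ := hG.returnTime_spec hR s
  obtain ⟨K, hK, hsK, h⟩ := hG.exists_return_piece hR.1 rfl hs h1 h2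
    fun i hi hik hmem => Nat.notMem_of_lt_sInf hik ⟨hi, hmem⟩
  exact ⟨_, K, hK, hsK, ⟨⟨_, hK⟩, s, hsK⟩, h⟩

/-- A piece of the pre-renormalization meets the critical orbit, so by uniqueness it is the one
constructed around that orbit point. -/
theorem exists_of_mem_preRenorm (hG : QuadBox c G) (hR : Recurrent c G) {K : Seg}
    (hK : K ∈ (preRenorm c G).pieces) :
    ∃ k, IsReturnSeg c G k K ∧ K.fst < K.snd ∧
      (centralPiece c G).fst < K.fst ∧ K.snd < (centralPiece c G).snd ∧
      EqOn (preRenorm c G).g G.g^[k] (pts K) ∧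
      (c ∈ pts K → IsFold c G.g^[k] K (centralPiece c G)) ∧
      (c ∉ pts K → CrossDiffeo G.g^[k] K.fst K.snd ∧
        G.g^[k] '' pts K = pts (centralPiece c G)) := by
  obtain ⟨⟨k, hKm⟩, s, hs⟩ := hK
  obtain ⟨k', K', hKm', hs', -, h1, h2, h3, h4⟩ :=
    hG.exists_preRenorm_piece hR (hKm.prop.2.1 hs)
  obtain rfl := hG.maximal_eq hKm hKm' hs hs'
  refine ⟨k', hKm'.prop, h1, h2, h3, fun z hz => ?_, h4⟩
  change G.g^[returnTime c G z] z = _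
  rw [hG.returnTime_eq hKm'.prop hz]

theorem preRenorm (hG : QuadBox c G) (hR : Recurrent c G) : QuadBox c (preRenorm c G) := by
  have hd : ∀ K ∈ (BoxMap.preRenorm c G).pieces, ∀ K' ∈ (BoxMap.preRenorm c G).pieces, K ≠ K' →
      Disjoint (pts K) (pts K') := by
    rintro K ⟨⟨k, hK⟩, -⟩ K' ⟨⟨k', hK'⟩, -⟩ hne
    rw [Set.disjoint_left]
    exact fun z hz hz' => hne (hG.maximal_eq hK hK' hz hz')
  obtain ⟨k, K, -, hcK, hK, -⟩ := hG.exists_preRenorm_piece hR (s := 0) hG.central.mem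
  replace hcK : c ∈ pts K := hcK
  have hcen := centralPiece_eq hd hK hcK
  refine ⟨fun K hK => ?_, fun K hK => ?_, hd, fun K hK hc => ?_, hcen ▸ hK, ?_⟩
  · obtain ⟨k, -, h, -⟩ := hG.exists_of_mem_preRenorm hR hK
    exact h
  · obtain ⟨k, -, -, h1, h2, -⟩ := hG.exists_of_mem_preRenorm hR hK
    exact ⟨h1, h2⟩
  · obtain ⟨k, -, -, -, -, he, -, h⟩ := hG.exists_of_mem_preRenorm hR hK
    exact ⟨(h hc).1.congr he, he.image_eq.trans (h hc).2⟩
  · obtain ⟨k, -, -, -, -, he, h, -⟩ := hG.exists_of_mem_preRenorm hR hK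
    obtain ⟨r, hr, h1, h2, f, hf, hfe, h3⟩ := h hcK
    rw [hcen]
    exact ⟨r, hr, h1, h2, f, hf, fun x hx => (he hx).trans (hfe x hx), h3⟩

end QuadBox

/-! ### Recurrence passes to the pre-renormalization. -/

section Orbit

variable {c : ℝ} {G : RMap}

/-- The number of iterates of `G` that make up `j` iterates of its pre-renormalization at `c`. -/
noncomputable def visitTime (c : ℝ) (G : RMap) : ℕ → ℕ
  | 0 => 0
  | j + 1 => returnTime c G (G.g^[visitTime c G j] c) + visitTime c G j

theorem iterate_preRenorm (j : ℕ) : (preRenorm c G).g^[j] c = G.g^[visitTime c G j] c := by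
  induction j with
  | zero => rfl
  | succ j ih =>
    rw [Function.iterate_succ_apply', ih]
    change G.g^[returnTime c G _] _ = _
    rw [visitTime, Function.iterate_add_apply]

theorem visitTime_strictMono (hG : QuadBox c G) (hR : Recurrent c G) : StrictMono (visitTime c G) :=
  strictMono_nat_of_lt_succ fun j => by
    have := (hG.returnTime_spec hR (visitTime c G j)).1
    rw [visitTime]
    omega

theorem visitTime_mem (hG : QuadBox c G) (hR : Recurrent c G) (j : ℕ) :
    G.g^[visitTime c G j] c ∈ pts (centralPiece c G) := by
  cases j with
  | zero => exact hG.central.mem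
  | succ j =>
    rw [visitTime, Function.iterate_add_apply]
    exact (hG.returnTime_spec hR _).2

/-- `visitTime` misses no visit: one strictly between consecutive visit times would contradict the
minimality of the return time. -/
theorem exists_visitTime_eq (hG : QuadBox c G) (hR : Recurrent c G) {m : ℕ} 
    (hm : G.g^[m] c ∈ pts (centralPiece c G)) :
    ∃ j, visitTime c G j = m := by
  have hex : ∃ j, m < visitTime c G (j + 1) :=
    ⟨m, (visitTime_strictMono hG hR).le_apply⟩
  classical
  obtain ⟨j, hj, hmin⟩ : ∃ j, m < visitTime c G (j + 1) ∧ visitTime c G j ≤ m := by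
    refine ⟨Nat.find hex, Nat.find_spec hex, ?_⟩
    rcases h : Nat.find hex with _ | i
    · exact Nat.zero_le _
    · exact not_lt.1 (Nat.find_min hex (by omega : i < Nat.find hex))
  refine ⟨j, le_antisymm hmin ?_⟩
  by_contra! hlt
  have : returnTime c G (G.g^[visitTime c G j] c) ≤ m - visitTime c G j := by
    refine Nat.sInf_le ⟨by omega, ?_⟩
    rwa [← Function.iterate_add_apply, Nat.sub_add_cancel hmin]
  rw [visitTime] at hj
  omega

/-- The central piece is a neighbourhood of `c`, so passages of the orbit near `c` may be taken to
be visits to it, and visits are iterates of the return map. -/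
theorem Recurrent.preRenorm (hG : QuadBox c G) (hR : Recurrent c G) : Recurrent c (preRenorm c G) := by
  refine ⟨fun m => ?_, mapClusterPt_iff_frequently.2 fun U hU =>
    Filter.frequently_atTop.2 fun N => ?_⟩
  · rw [iterate_preRenorm]
    obtain ⟨k, K, -, h, hK, -⟩ := hG.exists_preRenorm_piece hR (visitTime_mem hG hR m)
    exact ⟨K, hK, h⟩
  · obtain ⟨m, hm, hmU, hmI⟩ := Filter.frequently_atTop.1 (mapClusterPt_iff_frequently.1 hR.2 _
      (Filter.inter_mem hU hG.central_mem_nhds)) (visitTime c G N)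
    obtain ⟨j, rfl⟩ := exists_visitTime_eq hG hR hmI
    refine ⟨j, (visitTime_strictMono hG hR).le_iff_le.1 hm, ?_⟩
    rwa [iterate_preRenorm]

end Orbit

/-! ### Cross ratios, distortion and logarithms: the quantitative tools. -/

/-- Enlarging the ambient interval decreases the Poincaré length: for positive u and w the
hypothesis reads (1 + s/u)(1 + s/w) ≤ 1 + δ. -/
theorem cross_widen {s u w U W δ : ℝ} (hs : 0 ≤ s) (hδ : 0 ≤ δ) (hu : 0 ≤ u) (hw : 0 ≤ w)
    (hU : u ≤ U) (hW : w ≤ W) (h : s * (u + s + w) ≤ δ * (u * w)) :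
    s * (U + s + W) ≤ δ * (U * W) := by
  have hU0 : 0 ≤ U := hu.trans hU
  have hW0 : 0 ≤ W := hw.trans hW
  rcases hs.eq_or_lt with rfl | hs
  · rw [zero_mul]; positivity
  have hu : 0 < u := by
    refine lt_of_le_of_ne hu ?_
    rintro rfl
    nlinarith [mul_pos hs hs, mul_nonneg hs.le hw]
  have hw : 0 < w := by
    refine lt_of_le_of_ne hw ?_
    rintro rfl
    nlinarith [mul_pos hs hs, mul_nonneg hs.le hu.le]
  refine le_of_mul_le_mul_right ?_ (mul_pos hu hw)
  have h1 : U * (u * w) ≤ U * W * u := by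
    nlinarith [mul_le_mul_of_nonneg_left hW (mul_nonneg hU0 hu.le)]
  have h2 : s * (u * w) ≤ U * W * s := by nlinarith [mul_le_mul hU hW hw.le hU0]
  have h3 : W * (u * w) ≤ U * W * w := by
    nlinarith [mul_le_mul_of_nonneg_left hU (mul_nonneg hW0 hw.le)]
  calc s * (U + s + W) * (u * w) = s * (U * (u * w) + s * (u * w) + W * (u * w)) := by ring
    _ ≤ s * (U * W * u + U * W * s + U * W * w) := by gcongr
    _ = s * (u + s + w) * (U * W) := by ring
    _ ≤ δ * (u * w) * (U * W) := by gcongr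
    _ = δ * (U * W) * (u * w) := by ring

theorem exists_radii {c : ℝ} {K : Seg} (hK : K.fst < K.snd) (hc : c ∉ pts K) :
    ∃ a b, 0 < a ∧ a < b ∧ ((K.fst = c + a ∧ K.snd = c + b) ∨ (K.fst = c - b ∧ K.snd = c - a)) := by
  have : c < K.fst ∨ K.snd < c := by
    by_contra! hcon
    exact hc hcon
  rcases this with h | h
  · exact ⟨K.fst - c, K.snd - c, by linarith, by linarith, Or.inl ⟨by ring, by ring⟩⟩
  · exact ⟨c - K.snd, c - K.fst, by linarith, by linarith, Or.inr ⟨by ring, by ring⟩⟩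

/-- The distortion parameter controls the central branch. -/
theorem abs_sub_mul_le_of_distParam {c ρ r : ℝ} {G : RMap} {h : ℝ → ℝ}
    (hρ : distParam c G < ENNReal.ofReal ρ) (hmem : centralPiece c G ∈ G.pieces) (hr : 0 < r)
    (h1 : (centralPiece c G).fst = c - r) (h2 : (centralPiece c G).snd = c + r)
    (hh : CrossDiffeo h 0 (r ^ 2)) (hg : ∀ x ∈ pts (centralPiece c G), G.g x = h ((x - c) ^ 2))
    {u v s t : ℝ} (hu : 0 ≤ u) (huv : u ≤ v) (hv : v ≤ r ^ 2) (hs : 0 ≤ s) (hst : s ≤ t)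
    (ht : t ≤ r ^ 2) :
    |h v - h u| * (t - s) ≤ Real.exp ρ * |h t - h s| * (v - u) := by
  have himg : (fun x => (x - c) ^ 2) '' pts (centralPiece c G) = Icc 0 (r ^ 2) := by
    rw [pts, h1, h2]
    ext z
    constructor
    · rintro ⟨x, ⟨hx1, hx2⟩, rfl⟩
      exact ⟨sq_nonneg _, sq_le_sq' (by linarith) (by linarith)⟩
    · rintro ⟨hz1, hz2⟩
      have := Real.sqrt_nonneg z
      refine ⟨c + √z, ⟨by linarith, ?_⟩, ?_⟩
      · linarith [Real.sqrt_le_iff.2 ⟨hr.le, hz2⟩]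
      · simp only [add_sub_cancel_left]
        exact Real.sq_sqrt hz1
  -- On the central piece `quadFactor` takes the branch `c + √z`, which covers all of `[0, r ^ 2]`.
  have heq : EqOn (quadFactor c G (centralPiece c G)) h (Icc 0 (r ^ 2)) := by
    rintro z ⟨hz1, hz2⟩
    have := Real.sqrt_nonneg z
    rw [quadFactor, if_neg (by rw [h2]; linarith), hg _ ⟨by linarith, ?_⟩, add_sub_cancel_left,
      Real.sq_sqrt hz1]
    linarith [Real.sqrt_le_iff.2 ⟨hr.le, hz2⟩]
  have hU := uniqueDiffOn_Icc hh.lt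
  have hder : ∀ x ∈ Icc 0 (r ^ 2), 0 < |derivWithin h (Icc 0 (r ^ 2)) x| := by
    intro x hx
    obtain ⟨d, hd, hd'⟩ := hh.hasDeriv x hx
    rw [hd'.derivWithin (hU x hx)]
    exact abs_pos.2 hd
  have hdist : ∀ x ∈ Icc 0 (r ^ 2), ∀ y ∈ Icc 0 (r ^ 2), |derivWithin h (Icc 0 (r ^ 2)) x| ≤
      Real.exp ρ * |derivWithin h (Icc 0 (r ^ 2)) y| := by
    intro x hx y hy
    have hle : ENNReal.ofReal (Real.log (|derivWithin h (Icc 0 (r ^ 2)) x| /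
        |derivWithin h (Icc 0 (r ^ 2)) y|)) ≤ distParam c G := by
      rw [← derivWithin_congr heq (heq hx), ← derivWithin_congr heq (heq hy)]
      refine le_trans ?_ (le_iSup₂_of_le (f := fun K (_ : K ∈ G.pieces) => distortion
        (quadFactor c G K) ((fun x => (x - c) ^ 2) '' pts K)) (centralPiece c G) hmem le_rfl)
      rw [himg]
      exact le_iSup₂_of_le x hx (le_iSup₂_of_le y hy le_rfl)
    have hlt := (ENNReal.ofReal_lt_ofReal_iff'.1 (hle.trans_lt hρ)).1
    rw [Real.log_lt_iff_lt_exp (div_pos (hder x hx) (hder y hy)), div_lt_iff₀ (hder y hy)] at hlt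
    exact hlt.le
  -- By the mean value theorem slopes of `h` are derivatives of `h`, whose ratios are at most `exp
  -- ρ` by `hdist`.
  have hmvt : ∀ {u v}, 0 ≤ u → u < v → v ≤ r ^ 2 → ∃ ξ ∈ Icc 0 (r ^ 2),
      |h v - h u| = |derivWithin h (Icc 0 (r ^ 2)) ξ| * (v - u) := by
    intro u v hu huv hv
    have hat : ∀ x ∈ Ioo u v, HasDerivAt h (derivWithin h (Icc 0 (r ^ 2)) x) x := by
      intro x hx
      have hx' : x ∈ Icc 0 (r ^ 2) := ⟨by linarith [hx.1], by linarith [hx.2]⟩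
      obtain ⟨d, hd, hd'⟩ := hh.hasDeriv x hx'
      rw [hd'.derivWithin (hU x hx')]
      exact hd'.hasDerivAt (Icc_mem_nhds (by linarith [hx.1]) (by linarith [hx.2]))
    obtain ⟨ξ, hξ, e⟩ := exists_hasDerivAt_eq_slope h _ huv
      (hh.continuousOn.mono (Icc_subset_Icc hu hv)) hat
    have hvu : 0 < v - u := by linarith
    refine ⟨ξ, ⟨by linarith [hξ.1], by linarith [hξ.2]⟩, ?_⟩
    rw [e, abs_div, abs_of_pos hvu]
    field_simp
  rcases huv.eq_or_lt with rfl | huv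
  · simp
  rcases hst.eq_or_lt with rfl | hst
  · simp
  obtain ⟨ξ, hξ, e⟩ := hmvt hu huv hv
  obtain ⟨η, hη, e'⟩ := hmvt hs hst ht
  rw [e, e']
  have := hdist ξ hξ η hη
  have h3 : 0 ≤ (v - u) * (t - s) := mul_nonneg (by linarith) (by linarith)
  nlinarith [mul_le_mul_of_nonneg_right this h3]

theorem min_le_lamStar {c t : ℝ} {G : RMap} {K : Seg} (hK : K ∈ G.pieces) (hc : c ∉ pts K)
    (ht0 : 0 ≤ t) (ht : t ≤ poincareLen K G.J) : min t 1 ≤ lamStar c G := by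
  have h1 : ENNReal.ofReal t ≤ lam c G :=
    (ENNReal.ofReal_le_ofReal ht).trans (le_iSup₂_of_le
      (f := fun K (_ : K ∈ {K ∈ G.pieces | c ∉ pts K}) => ENNReal.ofReal (poincareLen K G.J))
      K ⟨hK, hc⟩ le_rfl)
  have h2 : ENNReal.ofReal (min t 1) ≤ min (lam c G) 1 := by
    refine le_min ((ENNReal.ofReal_le_ofReal (min_le_left _ _)).trans h1) ?_
    rw [← ENNReal.ofReal_one]
    exact ENNReal.ofReal_le_ofReal (min_le_right _ _)
  have h3 := ENNReal.toReal_mono (ne_top_of_le_ne_top ENNReal.one_ne_top (min_le_right _ _)) h2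
  rwa [ENNReal.toReal_ofReal (le_min ht0 zero_le_one)] at h3

theorem log_one_add_div_nonneg {x y : ℝ} (hx : 0 ≤ x) (hy : 0 ≤ y) : 0 ≤ Real.log (1 + x / y) :=
  Real.log_nonneg (by linarith [div_nonneg hx hy])

theorem le_two_mul_log {x : ℝ} (hx : 0 ≤ x) (h : Real.log (1 + x) ≤ 1) :
    x ≤ 2 * Real.log (1 + x) := by
  have hL : 0 ≤ Real.log (1 + x) := Real.log_nonneg (by linarith)
  have := Real.abs_exp_sub_one_le (x := Real.log (1 + x)) (by rwa [abs_of_nonneg hL])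
  rwa [Real.exp_log (by linarith), add_sub_cancel_left, abs_of_nonneg hL, abs_of_nonneg hx] at this

/-- Here `l` is the length of an image inside a piece of length `k`, `d` the distance from the piece
to ∂J, and `e` the remaining gap inside the piece. When the logarithm is at least 1 the bound by `e`
suffices; otherwise `k / d` is at most twice the logarithm. -/
theorem le_two_mul_min_log {l k d e δ : ℝ} (hδ : 0 ≤ δ) (hk : 0 ≤ k) (hd : 0 < d) (he : 0 ≤ e)
    (h1 : l ≤ δ * k) (h2 : l ≤ δ * e) :
    l ≤ 2 * δ * min (Real.log (1 + k / d)) 1 * (d + e) := by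
  have hL := log_one_add_div_nonneg hk hd.le
  set L := Real.log (1 + k / d) with hLdef
  rcases le_total 1 L with h | h
  · rw [min_eq_right h]
    nlinarith [mul_nonneg hδ hd.le, mul_nonneg hδ he]
  · rw [min_eq_left h]
    have := le_two_mul_log (div_nonneg hk hd.le) h
    rw [div_le_iff₀ hd] at this
    have h3 : δ * k ≤ δ * (2 * L * d) := by gcongr
    have h4 : 0 ≤ δ * L * e := by positivity
    linarith

namespace QuadBox

variable {c : ℝ} {G : RMap}

/-- Intervals returning to the central piece are well inside the non-central pieces. -/
theorem cross_le_of_return (hG : QuadBox c G) {r R δ : ℝ} (hr : 0 < r) (hrR : r < R)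
    (h1 : (centralPiece c G).fst = c - r) (h2 : (centralPiece c G).snd = c + r)
    (hJ1 : G.J.fst = c - R) (hJ2 : G.J.snd = c + R) (hδ : δ * (R - r) ^ 2 = 4 * r * R) (m : ℕ) :
    ∀ x y, x ≤ y → (∀ i < m, ∃ K ∈ G.pieces, c ∉ pts K ∧ ∀ z ∈ Icc x y, G.g^[i + 1] z ∈ pts K) →
      (∀ z ∈ Icc x y, G.g^[m + 1] z ∈ pts (centralPiece c G)) →
      ∀ K ∈ G.pieces, c ∉ pts K → Icc x y ⊆ pts K →
      (y - x) * (K.snd - K.fst) ≤ δ * ((x - K.fst) * (K.snd - y)) := by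
  -- By `hδ`, δ = (2r)(2R)/(R - r)² is the cross ratio of the central piece in `J`.
  have hδ0 : 0 ≤ δ := by
    have : 0 < δ * (R - r) ^ 2 := by rw [hδ]; have := hr.trans hrR; positivity
    exact (pos_of_mul_pos_left this (sq_nonneg _)).le
  -- One pullback: the branch on `K` maps onto `J` and does not decrease cross ratios, so a bound
  -- for the image in `J` passes to `[x, y]` in `K`.
  have step : ∀ x y, x ≤ y → ∀ K ∈ G.pieces, c ∉ pts K → Icc x y ⊆ pts K →
      (∀ x' y', x' ≤ y' → Icc x' y' ⊆ G.g '' Icc x y →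
        0 < x' - (c - R) ∧ 0 < c + R - y' ∧
          (y' - x') * (2 * R) ≤ δ * ((x' - (c - R)) * (c + R - y'))) →
      (y - x) * (K.snd - K.fst) ≤ δ * ((x - K.fst) * (K.snd - y)) := by
    intro x y hxy K hK hcK hsub hN
    obtain ⟨hf, hfi⟩ := hG.noncentral K hK hcK
    have mx := hsub (left_mem_Icc.2 hxy)
    have my := hsub (right_mem_Icc.2 hxy)
    have hcross := hf.cross K.fst x y K.snd le_rfl mx.1 hxy my.2 le_rfl
    have hcont : ContinuousOn G.g (Icc x y) := hf.continuousOn.mono hsub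
    have hmain : ∀ A B : ℝ, 0 < B → A * B ≤
        δ * B * ((x - K.fst) * (K.snd - y)) → A ≤ δ * ((x - K.fst) * (K.snd - y)) := by
      intro A B hB h
      refine le_of_mul_le_mul_right ?_ hB
      linarith
    rcases hf.mono with hm | hm
    · have hle := hm.monotoneOn mx my hxy
      have hend : G.g K.fst = c - R ∧ G.g K.snd = c + R := by
        have hlt := hm (left_mem_Icc.2 hf.lt.le) (right_mem_Icc.2 hf.lt.le) hf.lt
        rcases hf.endpoints hfi with h | h
        · rwa [hJ1, hJ2] at h
        · rw [hJ1, hJ2] at h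
          rw [h.1, h.2] at hlt
          linarith
      obtain ⟨h3, h4, h5⟩ := hN _ _ hle (intermediate_value_Icc hxy hcont)
      rw [hend.1, hend.2] at hcross
      refine hmain _ _ (mul_pos h3 h4) (hcross.trans ?_)
      refine mul_le_mul_of_nonneg_right ?_ (mul_nonneg (by linarith [mx.1]) (by linarith [my.2]))
      linarith
    · have hle := hm.antitoneOn mx my hxy
      have hend : G.g K.fst = c + R ∧ G.g K.snd = c - R := by
        have hlt := hm (left_mem_Icc.2 hf.lt.le) (right_mem_Icc.2 hf.lt.le) hf.lt
        rcases hf.endpoints hfi with h | h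
        · rw [hJ1, hJ2] at h
          rw [h.1, h.2] at hlt
          linarith
        · rwa [hJ1, hJ2] at h
      obtain ⟨h3, h4, h5⟩ := hN _ _ hle (intermediate_value_Icc' hxy hcont)
      rw [hend.1, hend.2] at hcross
      refine hmain _ _ (mul_pos h3 h4) (le_trans (le_of_eq ?_) (hcross.trans ?_))
      · ring
      refine mul_le_mul_of_nonneg_right ?_ (mul_nonneg (by linarith [mx.1]) (by linarith [my.2]))
      linarith
  induction m with
  | zero =>
    intro x y hxy _ hret K hK hcK hsub
    refine step x y hxy K hK hcK hsub fun x' y' hxy' himg => ?_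
    have hin : ∀ w ∈ Icc x' y', c - r ≤ w ∧ w ≤ c + r := by
      intro w hw
      obtain ⟨z, hz, rfl⟩ := himg hw
      have := hret z hz
      rw [zero_add, Function.iterate_one] at this
      rwa [pts, h1, h2] at this
    have hx' := (hin x' (left_mem_Icc.2 hxy')).1
    have hy' := (hin y' (right_mem_Icc.2 hxy')).2
    refine ⟨by linarith, by linarith, ?_⟩
    calc (y' - x') * (2 * R) ≤ (2 * r) * (2 * R) := by
          have : 0 ≤ 2 * R := by linarith
          gcongr; linarith
      _ = δ * ((R - r) * (R - r)) := by rw [← sq, hδ]; ring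
      _ ≤ δ * ((x' - (c - R)) * (c + R - y')) := by
          have : 0 ≤ R - r := by linarith
          exact mul_le_mul_of_nonneg_left
            (mul_le_mul (by linarith) (by linarith) this (by linarith)) hδ0
  | succ m ih =>
    intro x y hxy hpass hret K hK hcK hsub
    refine step x y hxy K hK hcK hsub fun x' y' hxy' himg => ?_
    obtain ⟨K₁, hK₁, hcK₁, hsub₁⟩ := hpass 0 (by omega)
    have hsub' : Icc x' y' ⊆ pts K₁ := by
      intro w hw
      obtain ⟨z, hz, rfl⟩ := himg hw
      simpa using hsub₁ z hz
    have h := ih x' y' hxy' (fun i hi => by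
      obtain ⟨K', hK', hcK', h'⟩ := hpass (i + 1) (by omega)
      refine ⟨K', hK', hcK', fun w hw => ?_⟩
      obtain ⟨z, hz, rfl⟩ := himg hw
      rw [← Function.iterate_succ_apply]
      exact h' z hz) (fun w hw => by
      obtain ⟨z, hz, rfl⟩ := himg hw
      rw [← Function.iterate_succ_apply]
      exact hret z hz) K₁ hK₁ hcK₁ hsub'
    have hJ := hG.interior K₁ hK₁
    rw [hJ1, hJ2] at hJ
    have hx' := (hsub' (left_mem_Icc.2 hxy')).1
    have hy' := (hsub' (right_mem_Icc.2 hxy')).2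
    refine ⟨by linarith, by linarith, ?_⟩
    -- The induction hypothesis bounds the cross ratio in `K₁`; the next pullback needs it in the
    -- larger interval `J`.
    have := cross_widen (s := y' - x') (u := x' - K₁.fst) (w := K₁.snd - y')
      (U := x' - (c - R)) (W := c + R - y') (by linarith) hδ0 (by linarith) (by linarith)
      (by linarith) (by linarith) (by linarith)
    linarith

end QuadBox

/-! ### The arithmetic of the three alternatives. -/

/-- The final alternative, in terms of the relevant lengths. -/
theorem scaling_alternative {μ ρ ε : ℝ} (hε : 0 < ε) (hμ0 : 0 < μ) (hμ1 : μ < 1)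
    {X R₀ R₁ R₂ a b l l' K κ : ℝ} (hκ : κ = (1 - μ) / (4 * Real.exp ρ)) (hρ : 0 ≤ ρ)
    (hR₀ : 0 < R₀) (ha : R₀ < a) (hab : a < b) (hb : b < R₁) (hR : R₁ < R₂)
    (hs₁ : R₀ / R₁ < μ) (hs₂ : R₁ / R₂ < μ) (hl : 0 ≤ l) (hl' : 0 ≤ l')
    (hK0 : 0 ≤ K)
    (hX : X ^ 2 * (R₁ - b) ≤ Real.exp ρ * (4 * R₀ * R₁ / (R₁ - R₀) ^ 2) * (b - a))
    (hlog : min (Real.log (1 + (b - a) / (R₁ - b))) 1 ≤ l)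
    (hK : K ≤ Real.log (1 + (a - R₀) / (2 * R₀)) + 1 / 2 * Real.log (1 + (a - R₀) / (b - a)))
    (hcase : κ * R₁ ≤ R₁ - b ∨ (b ^ 2 - a ^ 2) ≤
      Real.exp ρ * (2 * (4 * R₁ * R₂ / (R₂ - R₁) ^ 2) * l') * (R₁ ^ 2 - b ^ 2)) :
    let C := √(4 * Real.exp ρ / (1 - μ) ^ 2 * (2 + 1 / κ) + 128 * Real.exp ρ ^ 2 / (1 - μ) ^ 4)
    X ≤ C * (√l * Real.exp (-(1 - ε) * K / 2)) ∨ X ≤ C * Real.exp (-(1 + ε / 2) * K / 2) ∨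
      X ≤ C * √(R₀ / R₁ * (R₁ / R₂) * l') := by
  -- Here X = μ_{n+1}, the piece V has distances from a to b from c, and l, l' stand for λ_n^*,
  -- λ_{n-1}^*. Both summands under the root in `C` come from bounds on X²: the first when V is far
  -- from the boundary, the second when it is near.
  intro C
  set E := Real.exp ρ with hE
  have hE1 : 1 ≤ E := Real.one_le_exp hρ
  have hE0 : 0 < E := by linarith
  have hμ' : 0 < 1 - μ := by linarith
  have hκ0 : 0 < κ := by rw [hκ]; positivity
  have hκ4 : κ ≤ 1 / 4 := by
    rw [hκ, div_le_iff₀ (by positivity)]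
    linarith
  have hR₁ : 0 < R₁ := by linarith
  have hR₂ : 0 < R₂ := by linarith
  set m := R₀ / R₁ with hm
  set m' := R₁ / R₂ with hm'
  have hm0 : 0 < m := by positivity
  have hm'0 : 0 < m' := by positivity
  have hδ : ∀ {s t : ℝ}, 0 < s → s < t → s / t < μ →
      4 * s * t / (t - s) ^ 2 ≤ 4 / (1 - μ) ^ 2 * (s / t) := by
    intro s t hs hst h
    have ht : 0 < t := by linarith
    have hts : t * (1 - μ) ≤ t - s := by
      rw [div_lt_iff₀ ht] at h
      linarith
    calc 4 * s * t / (t - s) ^ 2 ≤ 4 * s * t / (t * (1 - μ)) ^ 2 := by gcongr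
      _ = 4 / (1 - μ) ^ 2 * (s / t) := by field_simp
  have hd : 0 < R₁ - b := by linarith
  have hv : 0 < b - a := by linarith
  set W := (b - a) / (R₁ - b) with hW
  have hW0 : 0 < W := by positivity
  set A := 4 * E / (1 - μ) ^ 2 with hA
  have hA0 : 0 < A := by positivity
  set B := 128 * E ^ 2 / (1 - μ) ^ 4 with hB
  have hB0 : 0 < B := by positivity
  -- Everything reduces to bounding W = |V|/(R₁ - b).
  have hXW : X ^ 2 ≤ A * m * W := by
    have h1 := hδ hR₀ (by linarith) hs₁
    rw [← le_div_iff₀ hd] at hX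
    calc X ^ 2 ≤ _ := hX
      _ = E * (4 * R₀ * R₁ / (R₁ - R₀) ^ 2) * W := by rw [hW]; ring
      _ ≤ E * (4 / (1 - μ) ^ 2 * m) * W := by gcongr
      _ = A * m * W := by rw [hA]; ring
  have hκi : 0 < 1 / κ := by positivity
  have hfin : ∀ T : ℝ, 0 ≤ T → X ^ 2 ≤ (A * (2 + 1 / κ) + B) * T → X ≤ C * √T := by
    intro T hT h
    change X ≤ √(A * (2 + 1 / κ) + B) * √T
    rw [← Real.sqrt_mul (by positivity)]
    exact Real.le_sqrt_of_sq_le h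
  have hsqexp : ∀ t : ℝ, √(Real.exp t) = Real.exp (t / 2) := fun t => (Real.exp_half t).symm
  have hcaseX : κ * R₁ ≤ R₁ - b → X ≤ C * (√l * Real.exp (-(1 - ε) * K / 2)) ∨
      X ≤ C * Real.exp (-(1 + ε / 2) * K / 2) := by
    intro hbig
    set x := Real.log (1 + (a - R₀) / (2 * R₀)) with hx
    set y := Real.log (1 + (a - R₀) / (b - a)) with hy
    have hg : 0 < a - R₀ := by linarith
    have hmx : m ≤ Real.exp (-x) := by
      have e : 1 + (a - R₀) / (2 * R₀) = (a + R₀) / (2 * R₀) := by field_simp; ring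
      rw [Real.exp_neg, hx, Real.exp_log (by positivity), e, inv_div, hm,
        div_le_div_iff₀ hR₁ (by linarith)]
      have := mul_le_mul_of_nonneg_left (show a + R₀ ≤ 2 * R₁ by linarith) hR₀.le
      linarith
    have hWl : W ≤ (2 + 1 / κ) * l := by
      rcases le_total 1 (Real.log (1 + W)) with h | h
      · rw [min_eq_right h] at hlog
        have h1 : W ≤ 1 / κ := by
          rw [hW, div_le_div_iff₀ hd hκ0, one_mul]
          have := mul_le_mul_of_nonneg_left (show b - a ≤ R₁ by linarith) hκ0.le
          linarith
        have := mul_le_mul_of_nonneg_left hlog (show 0 ≤ 2 + 1 / κ by positivity)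
        linarith
      · rw [min_eq_left h] at hlog
        have h1 := le_two_mul_log hW0.le h
        have := mul_nonneg hκi.le hl
        linarith
    have hWy : W ≤ 1 / κ * Real.exp (-y) := by
      rw [Real.exp_neg, hy, Real.exp_log (by positivity), hW]
      have e : 1 + (a - R₀) / (b - a) = (b - R₀) / (b - a) := by field_simp; ring
      rw [e, inv_div, div_mul_div_comm, one_mul]
      have := mul_le_mul_of_nonneg_left (show b - R₀ ≤ R₁ by linarith) hκ0.le
      have h3 : 0 < b - R₀ := by linarith
      gcongr
      linarith
    -- From K ≤ x + y/2: if y/2 ≤ εK then x ≥ (1 - ε)K; otherwise x + y ≥ K + y/2 ≥ (1 + ε)K, more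
    -- than required.
    rcases le_total (y / 2) (ε * K) with h | h
    · left
      have h0 : X ≤ C * √(l * Real.exp (-(1 - ε) * K)) := by
        refine hfin _ (by positivity) ?_
        have hexp : Real.exp (-x) ≤ Real.exp (-(1 - ε) * K) := by
          apply Real.exp_le_exp.2
          linarith
        calc X ^ 2 ≤ A * m * W := hXW
          _ ≤ A * Real.exp (-(1 - ε) * K) * ((2 + 1 / κ) * l) := by
            gcongr
            exact hmx.trans hexp
          _ = A * (2 + 1 / κ) * (l * Real.exp (-(1 - ε) * K)) := by ring
          _ ≤ _ := by gcongr; linarith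
      rwa [Real.sqrt_mul hl, hsqexp] at h0
    · right
      rw [← hsqexp]
      refine hfin _ (by positivity) ?_
      have hexp : Real.exp (-x) * Real.exp (-y) ≤ Real.exp (-(1 + ε / 2) * K) := by
        rw [← Real.exp_add]
        apply Real.exp_le_exp.2
        nlinarith [mul_nonneg hε.le hK0]
      calc X ^ 2 ≤ A * m * W := hXW
        _ ≤ A * Real.exp (-x) * (1 / κ * Real.exp (-y)) := by gcongr
        _ = A * (1 / κ) * (Real.exp (-x) * Real.exp (-y)) := by ring
        _ ≤ A * (1 / κ) * Real.exp (-(1 + ε / 2) * K) := by gcongr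
        _ ≤ (A * (2 + 1 / κ) + B) * Real.exp (-(1 + ε / 2) * K) := by
          have : 0 < A * 2 := by positivity
          gcongr
          linarith
  rcases le_or_gt (κ * R₁) (R₁ - b) with hbig | hsmall
  · rcases hcaseX hbig with h | h
    · exact Or.inl h
    · exact Or.inr (Or.inl h)
  · right; right
    have hb2 : R₁ / 2 ≤ b := by
      have := mul_le_mul_of_nonneg_right hκ4 hR₁.le
      linarith
    have hcase := hcase.resolve_left (not_le.2 hsmall)
    have h1 := hδ hR₁ hR hs₂
    set F := E * (2 * (4 * R₁ * R₂ / (R₂ - R₁) ^ 2) * l') with hF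
    have hF0 : 0 ≤ F := by positivity
    have hF1 : F ≤ 8 * E / (1 - μ) ^ 2 * (m' * l') := by
      calc F ≤ E * (2 * (4 / (1 - μ) ^ 2 * m') * l') := by rw [hF]; gcongr
        _ = _ := by ring
    -- The squares factor as (b - a)(b + a) and (R₁ - b)(R₁ + b). Since b ≥ R₁/2, the factors b + a
    -- and R₁ + b are comparable.
    have hWF : W ≤ 4 * F := by
      rw [hW, div_le_iff₀ hd]
      have h2 : R₁ + b ≤ 4 * (b + a) := by linarith
      have h3 : (b - a) * (b + a) ≤ 4 * F * (R₁ - b) * (b + a) := by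
        calc (b - a) * (b + a) = b ^ 2 - a ^ 2 := by ring
          _ ≤ F * (R₁ ^ 2 - b ^ 2) := hcase
          _ = F * (R₁ - b) * (R₁ + b) := by ring
          _ ≤ F * (R₁ - b) * (4 * (b + a)) := by gcongr
          _ = _ := by ring
      exact le_of_mul_le_mul_right h3 (by linarith)
    refine hfin _ (by positivity) ?_
    calc X ^ 2 ≤ A * m * W := hXW
      _ ≤ A * m * (4 * (8 * E / (1 - μ) ^ 2 * (m' * l'))) := by gcongr; linarith
      _ = B * (m * m' * l') := by rw [hA, hB]; field_simp; ring
      _ ≤ _ := by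
        gcongr
        have : 0 < A * (2 + 1 / κ) := by positivity
        linarith

/-! ### Geometric estimates for the central branch. -/

namespace QuadBox

variable {c : ℝ} {G : RMap}

theorem central_fold (hG : QuadBox c G) {r : ℝ} (h1 : (centralPiece c G).fst = c - r) :
    0 < r ∧ ∃ h : ℝ → ℝ, CrossDiffeo h 0 (r ^ 2) ∧
      (∀ x ∈ pts (centralPiece c G), G.g x = h ((x - c) ^ 2)) ∧ h 0 ∈ pts G.J ∧
      (h (r ^ 2) = G.J.fst ∨ h (r ^ 2) = G.J.snd) := by
  obtain ⟨r', hr', h1', -, h, hh⟩ := hG.central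
  obtain rfl : r' = r := by linarith
  exact ⟨hr', h, hh⟩

/-- `V` is the piece containing `G.g c`. With s the radius of the new central piece, `h` maps `[0, s
^ 2]` to length at most δ|V|, and `[0, r ^ 2]` to length at least R - b, since it joins `V` to ∂J.
Bounded distortion then controls s²/r², the square of the scaling factor. -/
theorem exists_piece_scaling_sq_le (hG : QuadBox c G) (hR : Recurrent c G) {r R ρ : ℝ}
    (hrR : r < R)
    (h1 : (centralPiece c G).fst = c - r) (h2 : (centralPiece c G).snd = c + r)
    (hJ1 : G.J.fst = c - R) (hJ2 : G.J.snd = c + R) (hρ : distParam c G < ENNReal.ofReal ρ)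
    (hnc : G.g c ∉ pts (centralPiece c G)) :
    ∃ V ∈ G.pieces, c ∉ pts V ∧ ∀ a b, 0 < a → a < b →
      ((V.fst = c + a ∧ V.snd = c + b) ∨ (V.fst = c - b ∧ V.snd = c - a)) →
      scaling c (BoxMap.preRenorm c G) ^ 2 * (R - b) ≤
        Real.exp ρ * (4 * r * R / (R - r) ^ 2) * (b - a) := by
  obtain ⟨hr, h, hh, hg, hh0, hhr⟩ := hG.central_fold h1
  have hG' := hG.preRenorm hR
  obtain ⟨s, hs, hs1, hs2, -⟩ := hG'.central
  obtain ⟨k, hk, -, hin1, hin2, -⟩ := hG.exists_of_mem_preRenorm hR hG'.mem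
  set I := centralPiece c (BoxMap.preRenorm c G) with hI
  have hcI : c ∈ pts I := hG'.central.mem
  -- A return time of 1 would put `G.g c` in the central piece.
  have hk2 : 2 ≤ k := by
    by_contra! hlt
    obtain rfl : k = 1 := by have := hk.1; omega
    exact hnc (hk.2.2.2 ⟨c, hcI, by simp⟩)
  obtain ⟨V, hV, hcV, hIV⟩ := hk.2.2.1 1 le_rfl (by omega)
  rw [Function.iterate_one] at hIV
  refine ⟨V, hV, hcV, fun a b ha hab hVab => ?_⟩
  have hsr : s < r := by linarith
  have hssr : s ^ 2 ≤ r ^ 2 := by gcongr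
  have hscal : scaling c (BoxMap.preRenorm c G) = s / r := by
    change len I / len (centralPiece c G) = s / r
    rw [len, len, hs1, hs2, h1, h2]
    rw [show c + s - (c - s) = 2 * s by ring, show c + r - (c - r) = 2 * r by ring]
    field_simp
  have hVJ := hG.interior V hV
  have hgc : G.g c = h 0 := by
    rw [hg c hG.central.mem]; simp
  have hsI : c + s ∈ pts I := ⟨by linarith, by linarith⟩
  have hgs : G.g (c + s) = h (s ^ 2) := by
    rw [hg _ ⟨by linarith, by linarith⟩]; simp
  have hcont : ContinuousOn G.g (uIcc c (c + s)) := by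
    have hsub : uIcc c (c + s) ⊆ pts (centralPiece c G) := by
      rw [uIcc_of_le (by linarith)]
      exact Icc_subset_Icc (by linarith) (by linarith)
    refine ContinuousOn.congr (f := fun z => h ((z - c) ^ 2)) ?_ fun z hz => hg z (hsub hz)
    refine hh.continuousOn.comp (by fun_prop) fun z hz => ?_
    rw [uIcc_of_le (by linarith)] at hz
    exact ⟨sq_nonneg _, sq_le_sq' (by linarith [hz.1]) (by linarith [hz.2])⟩
  have himg : uIcc (h 0) (h (s ^ 2)) ⊆ G.g '' pts I := by
    rw [← hgc, ← hgs]
    refine (intermediate_value_uIcc hcont).trans (image_mono ?_)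
    rw [uIcc_of_le (by linarith)]
    exact Icc_subset_Icc (by linarith) (by linarith)
  set δ := 4 * r * R / (R - r) ^ 2 with hδ
  have hRr : 0 < R - r := by linarith
  have hR0 : 0 < R := by linarith
  have hδ0 : 0 < δ := by positivity
  -- The interval is already an image under one iterate, so it returns after `k - 1 = (k - 2) + 1`
  -- further ones.
  have hD := hG.cross_le_of_return hr hrR h1 h2 hJ1 hJ2
    (δ := δ) (by rw [hδ]; field_simp) (k - 2) (min (h 0) (h (s ^ 2))) (max (h 0) (h (s ^ 2)))
    min_le_max (fun i hi => by
      obtain ⟨K, hK, hcK, hsub⟩ := hk.2.2.1 (i + 2) (by omega) (by omega)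
      refine ⟨K, hK, hcK, fun w hw => ?_⟩
      obtain ⟨z, hz, rfl⟩ := himg hw
      rw [← Function.iterate_succ_apply]
      exact hsub (mem_image_of_mem _ hz)) (fun w hw => by
      obtain ⟨z, hz, rfl⟩ := himg hw
      rw [← Function.iterate_succ_apply, show (k - 2 + 1).succ = k by omega]
      exact hk.2.2.2 (mem_image_of_mem _ hz)) V hV hcV (himg.trans hIV)
  have hmem1 := hIV (himg (left_mem_Icc.2 min_le_max))
  have hmem2 := hIV (himg (right_mem_Icc.2 min_le_max))
  have hlenV : V.snd - V.fst = b - a := by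
    rcases hVab with ⟨e1, e2⟩ | ⟨e1, e2⟩ <;> rw [e1, e2] <;> ring
  have hDlen : |h (s ^ 2) - h 0| ≤ δ * (b - a) := by
    have e : max (h 0) (h (s ^ 2)) - min (h 0) (h (s ^ 2)) = |h (s ^ 2) - h 0| :=
      max_sub_min_eq_abs _ _
    rw [e] at hD
    have hab' : 0 < b - a := by linarith
    refine le_of_mul_le_mul_right ?_ hab'
    rw [← hlenV, mul_assoc]
    refine hD.trans (mul_le_mul_of_nonneg_left (mul_le_mul ?_ ?_ ?_ ?_) hδ0.le)
    · linarith [hmem1.2, min_le_max (a := h 0) (b := h (s ^ 2))]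
    · linarith [hmem2.1]
    · linarith [hmem2.2]
    · linarith
  have hfar : R - b ≤ |h (r ^ 2) - h 0| := by
    have h0V : h 0 ∈ pts V := hgc ▸ hIV (mem_image_of_mem _ hcI)
    rcases hhr with e | e <;> rw [e]
    · rw [hJ1, le_abs]
      right
      rcases hVab with ⟨e1, e2⟩ | ⟨e1, e2⟩ <;> linarith [h0V.1, h0V.2]
    · rw [hJ2, le_abs]
      left
      rcases hVab with ⟨e1, e2⟩ | ⟨e1, e2⟩ <;> linarith [h0V.1, h0V.2]
  have hdist := abs_sub_mul_le_of_distParam hρ hG.mem hr h1 h2 hh hg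
    (u := 0) (v := r ^ 2) (s := 0) (t := s ^ 2) le_rfl (sq_nonneg _) le_rfl le_rfl (sq_nonneg _)
    hssr
  rw [sub_zero, sub_zero] at hdist
  rw [hscal, div_pow, div_mul_eq_mul_div, div_le_iff₀ (by positivity)]
  calc s ^ 2 * (R - b) ≤ |h (r ^ 2) - h 0| * s ^ 2 := by
        rw [mul_comm]; gcongr
    _ ≤ Real.exp ρ * |h (s ^ 2) - h 0| * r ^ 2 := hdist
    _ ≤ Real.exp ρ * (δ * (b - a)) * r ^ 2 := by gcongr
    _ = _ := by ring

/-- Compares `V` with the gap between it and the nearer end of the central piece, through their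
images under `h`. A return time of 1 forces a gap of definite proportion; a longer one makes `V`
small relative to the gap. -/
theorem outer_gap_alternative (hG : QuadBox c G) (hR : Recurrent c G) {r R ρ μ a b : ℝ}
    (hrR : r < R)
    (h1 : (centralPiece c G).fst = c - r) (h2 : (centralPiece c G).snd = c + r)
    (hJ1 : G.J.fst = c - R) (hJ2 : G.J.snd = c + R) (hρ : distParam c G < ENNReal.ofReal ρ)
    (hμ : r / R < μ) {V : Seg} (hV : V ∈ (BoxMap.preRenorm c G).pieces) (ha : 0 < a) (hab : a < b)
    (hVab : (V.fst = c + a ∧ V.snd = c + b) ∨ (V.fst = c - b ∧ V.snd = c - a)) :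
    (1 - μ) / (4 * Real.exp ρ) * r ≤ r - b ∨
      b ^ 2 - a ^ 2 ≤ Real.exp ρ * (2 * (4 * r * R / (R - r) ^ 2) * lamStar c G) *
        (r ^ 2 - b ^ 2) := by
  obtain ⟨hr, h, hh, hg, hh0, hhr⟩ := hG.central_fold h1
  obtain ⟨k, hk, -, hin1, hin2, -⟩ := hG.exists_of_mem_preRenorm hR hV
  have hbr : b < r := by rcases hVab with ⟨e1, e2⟩ | ⟨e1, e2⟩ <;> linarith
  have hR0 : 0 < R := hr.trans hrR
  have hb : 0 < b := ha.trans hab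
  have hE := Real.exp_pos ρ
  have hbr2 : b ^ 2 < r ^ 2 := by gcongr
  have hab2 : a ^ 2 < b ^ 2 := by gcongr
  have hVI : ∀ z ∈ uIcc V.fst V.snd, z ∈ pts V := by
    intro z hz
    rwa [uIcc_of_le V.fst_le_snd] at hz
  have hcont : ContinuousOn G.g (uIcc V.fst V.snd) := by
    refine ContinuousOn.congr (f := fun z => h ((z - c) ^ 2)) ?_ fun z hz =>
      hg z (hk.2.1 (hVI z hz))
    refine hh.continuousOn.comp (by fun_prop) fun z hz => ?_
    have := hk.2.1 (hVI z hz)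
    rw [pts, h1, h2] at this
    exact ⟨sq_nonneg _, sq_le_sq' (by linarith [this.1]) (by linarith [this.2])⟩
  have himg : uIcc (h (a ^ 2)) (h (b ^ 2)) ⊆ G.g '' pts V := by
    have hiv := (intermediate_value_uIcc hcont).trans (image_mono hVI)
    have hf := hg _ (hk.2.1 (hVI _ left_mem_uIcc))
    have hs := hg _ (hk.2.1 (hVI _ right_mem_uIcc))
    rw [hf, hs] at hiv
    rcases hVab with ⟨e1, e2⟩ | ⟨e1, e2⟩
    · simpa [e1, e2] using hiv
    · rw [uIcc_comm]
      simpa [e1, e2] using hiv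
  by_cases hk1 : k = 1
  · left
    -- The image of the gap joins the central piece to ∂J, so its length is at least R - r ≥ (1 -
    -- μ)R, against at most 2R for the whole image of `h`. Distortion gives r² - b² ≥ (1 - μ)r²/(2
    -- exp ρ), and r + b ≤ 2r supplies the remaining factor 2.
    subst hk1
    have hbI : h (b ^ 2) ∈ pts (centralPiece c G) := by
      obtain ⟨z, hz, e⟩ := himg right_mem_uIcc
      rw [← e]
      exact hk.2.2.2 ⟨z, hz, by simp⟩
    rw [pts, h1, h2] at hbI
    have hμ' : (1 - μ) * R ≤ R - r := by
      rw [div_lt_iff₀ hR0] at hμ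
      linarith
    have hdist := abs_sub_mul_le_of_distParam hρ hG.mem hr h1 h2 hh hg
      (u := b ^ 2) (v := r ^ 2) (s := 0) (t := r ^ 2) (sq_nonneg _) hbr2.le le_rfl le_rfl
      (sq_nonneg _) le_rfl
    have hlow : (1 - μ) * R ≤ |h (r ^ 2) - h (b ^ 2)| := by
      rcases hhr with e | e <;> rw [e]
      · rw [hJ1, le_abs]; right; linarith [hbI.1]
      · rw [hJ2, le_abs]; left; linarith [hbI.2]
    have hup : |h (r ^ 2) - h 0| ≤ 2 * R := by
      rw [pts, hJ1, hJ2] at hh0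
      rcases hhr with e | e <;> rw [e, abs_le]
      · rw [hJ1]; constructor <;> linarith [hh0.1, hh0.2]
      · rw [hJ2]; constructor <;> linarith [hh0.1, hh0.2]
    have h3 : (1 - μ) * R * r ^ 2 ≤ Real.exp ρ * (2 * R) * (r ^ 2 - b ^ 2) := by
      calc (1 - μ) * R * r ^ 2 ≤ |h (r ^ 2) - h (b ^ 2)| * (r ^ 2 - 0) := by
            rw [sub_zero]; gcongr
        _ ≤ Real.exp ρ * |h (r ^ 2) - h 0| * (r ^ 2 - b ^ 2) := hdist
        _ ≤ _ := by
          have : 0 ≤ r ^ 2 - b ^ 2 := by linarith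
          gcongr
    rw [div_mul_eq_mul_div, div_le_iff₀ (by positivity)]
    have h4 : (1 - μ) * r ^ 2 ≤ Real.exp ρ * 2 * (r ^ 2 - b ^ 2) := by
      refine le_of_mul_le_mul_right ?_ hR0
      linarith
    have h5 : r ^ 2 - b ^ 2 ≤ (r - b) * (2 * r) := by
      have : (r - b) * (r + b) ≤ (r - b) * (2 * r) :=
        mul_le_mul_of_nonneg_left (by linarith) (by linarith)
      linarith
    refine le_of_mul_le_mul_right ?_ hr
    calc (1 - μ) * r * r = (1 - μ) * r ^ 2 := by ring
      _ ≤ Real.exp ρ * 2 * (r ^ 2 - b ^ 2) := h4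
      _ ≤ Real.exp ρ * 2 * ((r - b) * (2 * r)) := by gcongr
      _ = _ := by ring
  · right
    have hk2 : 2 ≤ k := by have := hk.1; omega
    obtain ⟨K, hK, hcK, hVK⟩ := hk.2.2.1 1 le_rfl (by omega)
    rw [Function.iterate_one] at hVK
    set δ := 4 * r * R / (R - r) ^ 2 with hδ
    have hRr : 0 < R - r := by linarith
    have hδ0 : 0 < δ := by positivity
    have hD := hG.cross_le_of_return hr hrR h1 h2 hJ1 hJ2
      (δ := δ) (by rw [hδ]; field_simp) (k - 2) (min (h (a ^ 2)) (h (b ^ 2)))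
      (max (h (a ^ 2)) (h (b ^ 2)))
      min_le_max (fun i hi => by
        obtain ⟨K, hK, hcK, hsub⟩ := hk.2.2.1 (i + 2) (by omega) (by omega)
        refine ⟨K, hK, hcK, fun w hw => ?_⟩
        obtain ⟨z, hz, rfl⟩ := himg hw
        rw [← Function.iterate_succ_apply]
        exact hsub (mem_image_of_mem _ hz)) (fun w hw => by
        obtain ⟨z, hz, rfl⟩ := himg hw
        rw [← Function.iterate_succ_apply, show (k - 2 + 1).succ = k by omega]
        exact hk.2.2.2 (mem_image_of_mem _ hz)) K hK hcK (himg.trans hVK)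
    have hmem1 := hVK (himg (left_mem_Icc.2 min_le_max))
    have hmem2 := hVK (himg (right_mem_Icc.2 min_le_max))
    rw [max_sub_min_eq_abs] at hD
    have hKJ := hG.interior K hK
    have hK0 := hG.nondeg K hK
    rw [hJ1, hJ2] at hKJ
    have hl0 : 0 ≤ len K := by rw [len]; linarith
    have hlogL := log_one_add_div_nonneg hl0 (show 0 ≤ K.fst - (c - R) by linarith)
    have hlogR := log_one_add_div_nonneg hl0 (show 0 ≤ c + R - K.snd by linarith)
    have hlamL : min (Real.log (1 + len K / (K.fst - (c - R)))) 1 ≤ lamStar c G :=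
      min_le_lamStar hK hcK hlogL (by rw [poincareLen, hJ1, hJ2]; linarith)
    have hlamR : min (Real.log (1 + len K / (c + R - K.snd))) 1 ≤ lamStar c G :=
      min_le_lamStar hK hcK hlogR (by rw [poincareLen, hJ1, hJ2]; linarith)
    have hx := min_le_max (a := h (a ^ 2)) (b := h (b ^ 2))
    set x := min (h (a ^ 2)) (h (b ^ 2)) with hxdef
    set y := max (h (a ^ 2)) (h (b ^ 2)) with hydef
    have hlen : 0 < len K := by rw [len]; linarith
    have hw1 : 0 ≤ x - K.fst := by linarith [hmem1.1]
    have hw2 : 0 ≤ K.snd - y := by linarith [hmem2.2]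
    have hDK : ∀ w, 0 ≤ w → (x - K.fst) * (K.snd - y) ≤ w * len K →
        |h (b ^ 2) - h (a ^ 2)| ≤ δ * w := by
      intro w hw hle
      refine le_of_mul_le_mul_right ?_ hlen
      calc |h (b ^ 2) - h (a ^ 2)| * len K ≤ δ * ((x - K.fst) * (K.snd - y)) := hD
        _ ≤ δ * (w * len K) := by gcongr
        _ = _ := by ring
    have hDlen : |h (b ^ 2) - h (a ^ 2)| ≤ δ * len K := hDK _ hl0
      (mul_le_mul (by rw [len]; linarith) (by rw [len]; linarith) hw2 hl0)
    have hDl : |h (b ^ 2) - h (a ^ 2)| ≤ δ * (x - K.fst) := hDK _ hw1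
      (mul_le_mul_of_nonneg_left (by rw [len]; linarith) hw1)
    have hDr : |h (b ^ 2) - h (a ^ 2)| ≤ δ * (K.snd - y) := hDK _ hw2
      (by rw [mul_comm]; exact mul_le_mul_of_nonneg_left (by rw [len]; linarith) hw2)
    -- The image of the gap consists of the part of `J` beyond `K` and the part of `K` beyond the
    -- image of `V`. The monotonicity of `h` decides on which side this lies.
    have hkey : |h (b ^ 2) - h (a ^ 2)| ≤
        2 * δ * lamStar c G * |h (r ^ 2) - h (b ^ 2)| := by
      have hbx : x ≤ h (b ^ 2) := min_le_right _ _
      have hby : h (b ^ 2) ≤ y := le_max_right _ _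
      have ma : a ^ 2 ∈ Icc 0 (r ^ 2) := ⟨sq_nonneg _, by linarith⟩
      have mb : b ^ 2 ∈ Icc 0 (r ^ 2) := ⟨sq_nonneg _, by linarith⟩
      have mr : r ^ 2 ∈ Icc 0 (r ^ 2) := ⟨sq_nonneg _, le_rfl⟩
      rcases hh.mono with hm | hm
      · have h3 := hm ma mb hab2
        have h4 := hm mb mr hbr2
        have e : y = h (b ^ 2) := max_eq_right h3.le
        have e' : h (r ^ 2) = c + R := by
          rcases hhr with e' | e'
          · linarith [hmem2.1]
          · rw [e', hJ2]
        have := le_two_mul_min_log hδ0.le hl0 (show 0 < c + R - K.snd by linarith) hw2 hDlen hDr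
        have e₂ : |h (r ^ 2) - h (b ^ 2)| = c + R - K.snd + (K.snd - y) := by
          rw [abs_of_pos (sub_pos.2 h4), e', e]
          ring
        rw [e₂]
        refine this.trans ?_
        have : 0 ≤ c + R - K.snd + (K.snd - y) := by linarith
        gcongr
      · have h3 := hm ma mb hab2
        have h4 := hm mb mr hbr2
        have e : x = h (b ^ 2) := min_eq_right h3.le
        have e' : h (r ^ 2) = c - R := by
          rcases hhr with e' | e'
          · rw [e', hJ1]
          · linarith [hmem1.2]
        have := le_two_mul_min_log hδ0.le hl0 (show 0 < K.fst - (c - R) by linarith) hw1 hDlen hDl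
        have e₂ : |h (r ^ 2) - h (b ^ 2)| = K.fst - (c - R) + (x - K.fst) := by
          rw [abs_of_neg (sub_neg.2 h4), e', e]
          ring
        rw [e₂]
        refine this.trans ?_
        have : 0 ≤ K.fst - (c - R) + (x - K.fst) := by linarith
        gcongr
    have hpos : 0 < |h (r ^ 2) - h (b ^ 2)| := by
      refine abs_pos.2 (sub_ne_zero.2 fun e => ?_)
      have := hh.injOn ⟨sq_nonneg _, le_rfl⟩ ⟨sq_nonneg _, hbr2.le⟩ e
      linarith
    have hdist := abs_sub_mul_le_of_distParam hρ hG.mem hr h1 h2 hh hg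
      (u := b ^ 2) (v := r ^ 2) (s := a ^ 2) (t := b ^ 2) (sq_nonneg _) hbr2.le le_rfl
      (sq_nonneg _) hab2.le hbr2.le
    refine le_of_mul_le_mul_left ?_ hpos
    have : 0 ≤ r ^ 2 - b ^ 2 := by linarith
    calc |h (r ^ 2) - h (b ^ 2)| * (b ^ 2 - a ^ 2)
        ≤ Real.exp ρ * |h (b ^ 2) - h (a ^ 2)| * (r ^ 2 - b ^ 2) := hdist
      _ ≤ Real.exp ρ * (2 * δ * lamStar c G * |h (r ^ 2) - h (b ^ 2)|) * (r ^ 2 - b ^ 2) := by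
        gcongr
      _ = _ := by ring

theorem asymLen_nonneg (hG : QuadBox c G) {U V : Seg} (hU : U ∈ G.pieces) (hV : V ∈ G.pieces)
    (h : Closer c U V) : 0 ≤ asymLen U V := by
  have h1 := hG.nondeg U hU
  have h2 := hG.nondeg V hV
  have hgap : 0 ≤ gapLen U V := by
    rcases h with h | h
    · exact le_max_of_le_left (by linarith)
    · exact le_max_of_le_right (by linarith)
  have h3 := log_one_add_div_nonneg hgap (show 0 ≤ len U by rw [len]; linarith)
  have h4 := log_one_add_div_nonneg hgap (show 0 ≤ len V by rw [len]; linarith)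
  rw [asymLen]
  linarith

theorem gapParam_nonneg (hG : QuadBox c G) : 0 ≤ gapParam c G := by
  refine Real.sInf_nonneg ?_
  rintro q ⟨U, hU, V, hV, h, rfl⟩
  exact hG.asymLen_nonneg hU hV h

theorem gapParam_le (hG : QuadBox c G) {U V : Seg} (hU : U ∈ G.pieces) (hV : V ∈ G.pieces)
    (h : Closer c U V) : gapParam c G ≤ asymLen U V := by
  refine csInf_le ⟨0, ?_⟩ ⟨U, hU, V, hV, h, rfl⟩
  rintro q ⟨U, hU, V, hV, h, rfl⟩
  exact hG.asymLen_nonneg hU hV h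

end QuadBox

/-! ### Assembly over two consecutive levels. -/

/-- `G` and `H` play the roles of g_{n-1} and g_n. The bound on the new scaling factor is applied to
`H`, the outer gap alternative to `G`, both for the same piece `V` of `H`. -/
theorem scaling_preRenorm_preRenorm {c ρ μ ε R₂ : ℝ} {G : RMap} (hρ : 0 ≤ ρ) (hμ0 : 0 < μ)
    (hμ1 : μ < 1) (hε : 0 < ε) (hG : QuadBox c G) (hR : Recurrent c G)
    (hJ1 : G.J.fst = c - R₂) (hJ2 : G.J.snd = c + R₂)
    (hρ₁ : distParam c G < ENNReal.ofReal ρ)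
    (hρ₂ : distParam c (preRenorm c G) < ENNReal.ofReal ρ)
    (hs₁ : scaling c G < μ) (hs₂ : scaling c (preRenorm c G) < μ)
    (hnc : (preRenorm c G).g c ∉ pts (centralPiece c (preRenorm c G))) :
    let C := √(4 * Real.exp ρ / (1 - μ) ^ 2 * (2 + 1 / ((1 - μ) / (4 * Real.exp ρ))) +
      128 * Real.exp ρ ^ 2 / (1 - μ) ^ 4)
    scaling c (preRenorm c (preRenorm c G)) ≤ C * (√(lamStar c (preRenorm c G)) *
        Real.exp (-(1 - ε) * gapParam c (preRenorm c G) / 2)) ∨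
      scaling c (preRenorm c (preRenorm c G)) ≤
        C * Real.exp (-(1 + ε / 2) * gapParam c (preRenorm c G) / 2) ∨
      scaling c (preRenorm c (preRenorm c G)) ≤
        C * √(scaling c (preRenorm c G) * scaling c G * lamStar c G) := by
  have hH := hG.preRenorm hR
  have hRH := hR.preRenorm hG
  set H := preRenorm c G with hHdef
  obtain ⟨R₁, hR₁, hI1, hI2, -⟩ := hG.central
  obtain ⟨R₀, hR₀, hK1, hK2, -⟩ := hH.central
  have hHJ1 : H.J.fst = c - R₁ := hI1
  have hHJ2 : H.J.snd = c + R₁ := hI2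
  have hin := hG.interior _ hG.mem
  have hin' := hH.interior _ hH.mem
  have hR₁₂ : R₁ < R₂ := by linarith
  have hR₀₁ : R₀ < R₁ := by linarith
  have hsG : scaling c G = R₁ / R₂ := by
    rw [scaling, len, len, hI1, hI2, hJ1, hJ2, show c + R₁ - (c - R₁) = 2 * R₁ by ring,
      show c + R₂ - (c - R₂) = 2 * R₂ by ring]
    field_simp
  have hsH : scaling c H = R₀ / R₁ := by
    rw [scaling, len, len, hK1, hK2, hHJ1, hHJ2, show c + R₀ - (c - R₀) = 2 * R₀ by ring,
      show c + R₁ - (c - R₁) = 2 * R₁ by ring]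
    field_simp
  obtain ⟨V, hV, hcV, hX⟩ := hH.exists_piece_scaling_sq_le hRH hR₀₁ hK1 hK2 hHJ1 hHJ2 hρ₂ hnc
  obtain ⟨a, b, ha, hab, hVab⟩ := exists_radii (hH.nondeg V hV) hcV
  have hVin := hH.interior V hV
  have hb : b < R₁ := by rcases hVab with ⟨e1, e2⟩ | ⟨e1, e2⟩ <;> linarith
  have haR : R₀ < a := by
    by_contra! hle
    have : c + a ∈ pts V ∨ c - a ∈ pts V := by
      rcases hVab with ⟨e1, e2⟩ | ⟨e1, e2⟩
      · exact Or.inl ⟨by linarith, by linarith⟩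
      · exact Or.inr ⟨by linarith, by linarith⟩
    rcases this with h | h
    · exact hH.not_mem_central hV hcV h ⟨by linarith, by linarith⟩
    · exact hH.not_mem_central hV hcV h ⟨by linarith, by linarith⟩
  have hlenV : len V = b - a := by
    rw [len]
    rcases hVab with ⟨e1, e2⟩ | ⟨e1, e2⟩ <;> rw [e1, e2] <;> ring
  have hlenK : len (centralPiece c H) = 2 * R₀ := by rw [len, hK1, hK2]; ring
  have hgap : gapLen (centralPiece c H) V = a - R₀ := by
    rw [gapLen, hK1, hK2]
    rcases hVab with ⟨e1, e2⟩ | ⟨e1, e2⟩ <;> rw [e1, e2]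
    · rw [max_eq_left (by linarith)]; ring
    · rw [max_eq_right (by linarith)]; ring
  have hcl : Closer c (centralPiece c H) V := by
    rcases hVab with ⟨e1, e2⟩ | ⟨e1, e2⟩
    · exact Or.inl ⟨by linarith, by linarith⟩
    · exact Or.inr ⟨by linarith, by linarith⟩
  -- The central piece and `V` form one of the pairs in the infimum defining K_n.
  have hK := hH.gapParam_le hH.mem hV hcl
  rw [asymLen, hgap, hlenV, hlenK] at hK
  have hlog : min (Real.log (1 + (b - a) / (R₁ - b))) 1 ≤ lamStar c H := by
    refine min_le_lamStar hV hcV (log_one_add_div_nonneg (by linarith) (by linarith)) ?_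
    rw [poincareLen, hlenV, hHJ1, hHJ2]
    rcases hVab with ⟨e1, e2⟩ | ⟨e1, e2⟩ <;> rw [e1, e2]
    · have := log_one_add_div_nonneg (x := b - a) (y := c + a - (c - R₁)) (by linarith)
        (by linarith)
      rw [show c + R₁ - (c + b) = R₁ - b by ring]
      linarith
    · have := log_one_add_div_nonneg (x := b - a) (y := c + R₁ - (c - a)) (by linarith)
        (by linarith)
      rw [show c - b - (c - R₁) = R₁ - b by ring]
      linarith
  rw [hsG] at hs₁
  rw [hsH] at hs₂
  rw [hsH, hsG]
  exact scaling_alternative hε hμ0 hμ1 rfl hρ hR₀ haR hab hb hR₁₂ hs₂ hs₁ ENNReal.toReal_nonneg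
    ENNReal.toReal_nonneg hH.gapParam_nonneg (hX a b ha hab hVab) hlog hK
    (hG.outer_gap_alternative hR hR₁₂ hI1 hI2 hJ1 hJ2 hρ₁ hs₁ hV ha hab hVab)

theorem ClassT.iterate_preRenorm {c : ℝ} {G : RMap} (hG : ClassT c G) (hR : Recurrent c G)
    (N : ℕ) : QuadBox c ((preRenorm c)^[N] G) ∧ Recurrent c ((preRenorm c)^[N] G) := by
  induction N with
  | zero => exact ⟨hG.quadBox, hR⟩
  | succ N ih =>
    rw [Function.iterate_succ_apply']
    exact ⟨ih.1.preRenorm ih.2, ih.2.preRenorm ih.1⟩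

end BoxMap

theorem lemma3p13 (μbar ρbar ε : ℝ) (hρ : 0 < ρbar) (hρμ : ρbar < μbar) (hμ : μbar < 1)
    (hε : 0 < ε) :
    ∃ C > 0, ∀ (c : ℝ) (G : BoxMap.RMap), BoxMap.ClassT c G → BoxMap.Recurrent c G →
      ∀ n : ℕ, 2 ≤ n → (n = 2 → G.J.fst + G.J.snd = 2 * c) →
      BoxMap.distParam c (BoxMap.level c G (n - 1)) < ENNReal.ofReal ρbar →
      BoxMap.distParam c (BoxMap.level c G n) < ENNReal.ofReal ρbar →
      BoxMap.scaling c (BoxMap.level c G (n - 1)) < μbar →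
      BoxMap.scaling c (BoxMap.level c G n) < μbar →
      (BoxMap.level c G n).g c ∉ BoxMap.pts (BoxMap.centralPiece c (BoxMap.level c G n)) →
      (BoxMap.scaling c (BoxMap.level c G (n + 1)) ≤
          C * (√(BoxMap.lamStar c (BoxMap.level c G n)) *
            Real.exp (-(1 - ε) * BoxMap.gapParam c (BoxMap.level c G n) / 2)) ∨
        BoxMap.scaling c (BoxMap.level c G (n + 1)) ≤
          C * Real.exp (-(1 + ε / 2) * BoxMap.gapParam c (BoxMap.level c G n) / 2) ∨
        BoxMap.scaling c (BoxMap.level c G (n + 1)) ≤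
          C * √(BoxMap.scaling c (BoxMap.level c G n) *
            BoxMap.scaling c (BoxMap.level c G (n - 1)) *
            BoxMap.lamStar c (BoxMap.level c G (n - 1)))) := by
  have hE := Real.exp_pos ρbar
  have hμ' : 0 < 1 - μbar := by linarith
  refine ⟨√(4 * Real.exp ρbar / (1 - μbar) ^ 2 * (2 + 1 / ((1 - μbar) / (4 * Real.exp ρbar))) +
    128 * Real.exp ρbar ^ 2 / (1 - μbar) ^ 4), by positivity, ?_⟩
  intro c G hG hR n hn hsym hρ₁ hρ₂ hs₁ hs₂ hnc
  obtain ⟨N, rfl⟩ : ∃ N, n = N + 2 := ⟨n - 2, by omega⟩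
  have e₁ : BoxMap.level c G (N + 2 - 1) = (BoxMap.preRenorm c)^[N] G := rfl
  have e₂ : BoxMap.level c G (N + 2) = BoxMap.preRenorm c ((BoxMap.preRenorm c)^[N] G) :=
    Function.iterate_succ_apply' _ _ _
  have e₃ : BoxMap.level c G (N + 2 + 1) =
      BoxMap.preRenorm c (BoxMap.preRenorm c ((BoxMap.preRenorm c)^[N] G)) := by
    rw [← e₂]
    exact Function.iterate_succ_apply' _ _ _
  rw [e₁] at hρ₁ hs₁ ⊢
  rw [e₂] at hρ₂ hs₂ hnc ⊢
  rw [e₃]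
  obtain ⟨hQ, hRN⟩ := hG.iterate_preRenorm hR N
  -- The range of level n - 1 must be symmetric about `c`. For n > 2 it is a central piece of the
  -- preceding level; for n = 2 it is the original `J`.
  obtain ⟨R₂, hJ1, hJ2⟩ : ∃ R₂, ((BoxMap.preRenorm c)^[N] G).J.fst = c - R₂ ∧
      ((BoxMap.preRenorm c)^[N] G).J.snd = c + R₂ := by
    rcases N with _ | N
    · refine ⟨G.J.snd - c, ?_, ?_⟩
      · change G.J.fst = _
        linarith [hsym rfl]
      · change G.J.snd = _
        ring
    · obtain ⟨r, -, h1, h2, -⟩ := (hG.iterate_preRenorm hR N).1.central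
      rw [Function.iterate_succ_apply']
      exact ⟨r, h1, h2⟩
  exact BoxMap.scaling_preRenorm_preRenorm hρ.le (hρ.trans hρμ) hμ hε hQ hRN hJ1 hJ2 hρ₁ hρ₂ hs₁
    hs₂ hnc
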